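/- Let $n\ge 1$, and let $[X_1,\dots,X_{n+1}]$ be homogeneous coordinates (row vectors) on $\mathbb{C}P_n$. For a bivector field $\pi$ write $\{f,g\}=\pi(df,dg)$, and let $\frac12\pi^{ab}\partial_a\wedge\partial_b$ be its local form. Let $\omega_\lambda$ be the Fubini--Study symplectic form, normalized as $$\omega_\lambda=-i\,\partial\bar\partial\log(1+|z|^2)$$ in each affine chart, and let $\pi_\lambda$ be its inverse: for every smooth $f$, the vector field $\{f,\cdot\}_{\pi_\lambda}=X_f$ satisfies $\omega_\lambda(X_f,\cdot)=df$. Let $\pi_0$ be the Bruhat--Poisson structure, that is, the smooth bivector field on $\mathbb{C}P_n$ which on the dense cell $X_{n+1}\neq0$ is $$\pi_0=i\sum_{k=1}^n(1+|y_k|^2)\,\partial_{y_k}\wedge\partial_{\bar y_k},\qquad y_k=\frac{z_k}{\sqrt{1+\sum_{k<j\le n}|z_j|^2}},\quad z_k=\frac{X_k}{X_{n+1}} .$$ For $t\in\mathbb{R}$ put $\pi_t=\pi_0+t\,\pi_\lambda$. Let $V_{FS}=\frac1{n!}\omega_\lambda^n$. The modular vector field of $\pi_t$ with respect to $V_{FS}$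 is $\chi_{FS}=\operatorname{div}_{V_{FS}}\pi_t$, i.e. the vector field such that, for every smooth $f$, $\chi_{FS}(f)$ is the divergence with respect to $V_{FS}$ of the Hamiltonian vector field $\{\cdot,f\}_{\pi_t}$ (if $V_{FS}=\rho\,dx^1\wedge\dots\wedge dx^{2n}$ locally, then $\chi_{FS}^b=\rho^{-1}\partial_a(\rho\,\pi_t^{ab})$). The modular class is the class of $\chi_{FS}$ in the first Lichnerowicz--Poisson cohomology $H^1_{LP}(\mathbb{C}P_n,\pi_t)$, i.e. Poisson vector fields modulo Hamiltonian vector fields. For $k=1,\dots,n$ let $$H_k=\frac{i}{n+1}\operatorname{diag}(\underbrace{n+1-k,\dots,n+1-k}_{k},\underbrace{-k,\dots,-k}_{n+1-k}),$$ and for a matrix $H$ let $\sigma_H$ be the fundamental vector field generating $[X]\mapsto[X\exp(sH)]$. **Lemma.** For every $t\in\mathbb{R}$, the modular vector field of $(\mathbb{C}P_n,\pi_t)$ with respect to $V_{FS}$ is $$\chi_{FS}=\sum_{k=1}^n\sigma_{H_k},$$ and it is a Poisson vector field for $\pi_t$. Moreover $\sum_{k=1}^nH_k=\frac{i}{2}\sum_{1\le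 a<b\le n+1}(E_{aa}-E_{bb})$, the half-sum of the positive roots (the root $\varepsilon_a-\varepsilon_b$ being identified with $i(E_{aa}-E_{bb})$), so $\chi_{FS}$ is the fundamental vector field of the half-sum of positive roots. For every $t\in[0,1]$ the modular class of $(\mathbb{C}P_n,\pi_t)$ is nonzero. -/

import Mathlib

open scoped ContDiff ComplexConjugate
open Complex (I)

namespace CPn

noncomputable section

/-- Complex projective space of dimension `n`; the point `[X]` is the line through `X ≠ 0`. The
homogeneous coordinates `X₁, …, X_{n+1}` are indexed by `Fin (n + 1)`, starting from `0`. -/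
abbrev CP (n : ℕ) : Type := Projectivization ℂ (Fin (n + 1) → ℂ)

/-- The vector with `1` in place `j` and the entries of `z` in the other places. -/
def affineVec {n : ℕ} (j : Fin (n + 1)) (z : Fin n → ℂ) : Fin (n + 1) → ℂ :=
  j.insertNth (α := fun _ => ℂ) 1 z

@[simp] theorem affineVec_same {n : ℕ} (j : Fin (n + 1)) (z : Fin n → ℂ) :
    affineVec j z j = 1 := by simp [affineVec]

@[simp] theorem affineVec_succAbove {n : ℕ} (j : Fin (n + 1)) (z : Fin n → ℂ) (a : Fin n) :
    affineVec j z (j.succAbove a) = z a := by simp [affineVec]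

theorem affineVec_ne_zero {n : ℕ} (j : Fin (n + 1)) (z : Fin n → ℂ) : affineVec j z ≠ 0 := by
  intro h
  simpa using congrFun h j

/-- The (inverse of the) `j`-th affine chart, `z ↦ [z with 1 inserted in place j]`. These
`n + 1` maps form the standard atlas. -/
def affineChart {n : ℕ} (j : Fin (n + 1)) (z : Fin n → ℂ) : CP n :=
  Projectivization.mk ℂ (affineVec j z) (affineVec_ne_zero j z)

/-- Real-valued functions on projective space that are smooth in each chart of the standard
atlas. -/
def smoothFunctions (n : ℕ) : Subalgebra ℝ (CP n → ℝ) where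
  carrier := {f | ∀ j, ContDiff ℝ ∞ fun z => f (affineChart j z)}
  mul_mem' hf hg j := (hf j).mul (hg j)
  add_mem' hf hg j := (hf j).add (hg j)
  algebraMap_mem' r _ := contDiff_const (c := r)

/-- The algebra of smooth real functions on projective space. -/
def C (n : ℕ) : Type := smoothFunctions n

instance (n : ℕ) : CommRing (C n) := inferInstanceAs (CommRing (smoothFunctions n))

instance (n : ℕ) : Algebra ℝ (C n) := inferInstanceAs (Algebra ℝ (smoothFunctions n))

instance (n : ℕ) : CoeOut (C n) (CP n → ℝ) := ⟨Subtype.val⟩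

@[ext] theorem C.ext {n : ℕ} {f g : C n} (h : ∀ p, (f : CP n → ℝ) p = (g : CP n → ℝ) p) : f = g :=
  Subtype.ext (funext h)

@[simp] theorem C.coe_add {n : ℕ} (f g : C n) : ((f + g : C n) : CP n → ℝ) = f + g := rfl

@[simp] theorem C.coe_neg {n : ℕ} (f : C n) : ((-f : C n) : CP n → ℝ) = -f := rfl

@[simp] theorem C.coe_sub {n : ℕ} (f g : C n) : ((f - g : C n) : CP n → ℝ) = f - g := rfl

@[simp] theorem C.coe_mul {n : ℕ} (f g : C n) : ((f * g : C n) : CP n → ℝ) = f * g := rfl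

@[simp] theorem C.coe_smul {n : ℕ} (r : ℝ) (f : C n) : ((r • f : C n) : CP n → ℝ) = r • f := rfl

@[simp] theorem C.coe_zero {n : ℕ} : ((0 : C n) : CP n → ℝ) = 0 := rfl

@[simp] theorem C.coe_one {n : ℕ} : ((1 : C n) : CP n → ℝ) = 1 := rfl

/-- Smooth vector fields, as derivations of the algebra of smooth functions. -/
abbrev VectorField (n : ℕ) : Type := Derivation ℝ (C n) (C n)

/-- The pull-back of a function to `ℂⁿ⁺¹ ∖ {0}` (extended by `0`). -/
def lift {n : ℕ} (f : CP n → ℝ) (x : Fin (n + 1) → ℂ) : ℝ :=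
  open Classical in if h : x ≠ 0 then f (Projectivization.mk ℂ x h) else 0

theorem lift_of_ne {n : ℕ} (f : CP n → ℝ) {x : Fin (n + 1) → ℂ} (h : x ≠ 0) :
    lift f x = f (Projectivization.mk ℂ x h) := by simp [lift, h]

theorem lift_rep {n : ℕ} (f : CP n → ℝ) (p : CP n) : lift f p.rep = f p := by
  rw [lift_of_ne f p.rep_nonzero, p.mk_rep]

theorem lift_smul {n : ℕ} (f : CP n → ℝ) {c : ℂ} (hc : c ≠ 0) (x : Fin (n + 1) → ℂ) :
    lift f (c • x) = lift f x := by
  by_cases h : x = 0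
  · simp [h]
  · rw [lift_of_ne f h, lift_of_ne f (smul_ne_zero hc h)]
    congr 1
    rw [Projectivization.mk_eq_mk_iff']
    exact ⟨c, rfl⟩

theorem contDiffAt_lift {n : ℕ} (f : C n) {x : Fin (n + 1) → ℂ} (hx : x ≠ 0) :
    ContDiffAt ℝ ∞ (lift (f : CP n → ℝ)) x := by
  obtain ⟨j, hj⟩ : ∃ j, x j ≠ 0 := by
    by_contra! h
    exact hx (funext h)
  have h1 : (fun y : Fin (n + 1) → ℂ =>
      (f : CP n → ℝ) (affineChart j fun a => y (j.succAbove a) * (y j)⁻¹)) =ᶠ[nhds x]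
        lift (f : CP n → ℝ) := by
    have : ∀ᶠ y : Fin (n + 1) → ℂ in nhds x, y j ≠ 0 :=
      (continuous_apply j).continuousAt.eventually_ne hj
    filter_upwards [this] with y hy
    have hy0 : y ≠ 0 := fun h => hy (by simp [h])
    rw [lift_of_ne _ hy0]
    refine congrArg (f : CP n → ℝ) ?_
    rw [affineChart, Projectivization.mk_eq_mk_iff']
    refine ⟨(y j)⁻¹, ?_⟩
    ext k
    rcases Fin.eq_self_or_eq_succAbove j k with rfl | ⟨a, rfl⟩
    · simp [hy]
    · simp [mul_comm]
  refine ContDiffAt.congr_of_eventuallyEq ?_ h1.symm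
  refine ContDiffAt.comp (g := fun z => (f : CP n → ℝ) (affineChart j z)) x
    (f.2 j).contDiffAt ?_
  refine contDiffAt_pi.2 fun a => ?_
  have e : ∀ k : Fin (n + 1), ContDiffAt ℝ ∞ (fun y : Fin (n + 1) → ℂ => y k) x := fun k =>
    contDiffAt_apply ..
  exact (e _).mul ((e j).inv hj)

theorem lift_affineVec {n : ℕ} (f : CP n → ℝ) (j : Fin (n + 1)) (z : Fin n → ℂ) :
    lift f (affineVec j z) = f (affineChart j z) := lift_of_ne f _

theorem contDiff_affineVec {n : ℕ} (j : Fin (n + 1)) :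
    ContDiff ℝ ∞ (affineVec j : (Fin n → ℂ) → Fin (n + 1) → ℂ) := by
  refine contDiff_pi.2 fun k => ?_
  rcases Fin.eq_self_or_eq_succAbove j k with rfl | ⟨a, rfl⟩
  · simpa using contDiff_const
  · simpa using contDiff_apply ℝ ℂ a

theorem differentiableAt_lift {n : ℕ} (f : C n) {x : Fin (n + 1) → ℂ} (hx : x ≠ 0) :
    DifferentiableAt ℝ (lift (f : CP n → ℝ)) x :=
  (contDiffAt_lift f hx).differentiableAt (by simp)

theorem fderiv_lift_smul {n : ℕ} (f : C n) {c : ℂ} (hc : c ≠ 0) {x : Fin (n + 1) → ℂ}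
    (hx : x ≠ 0) (v : Fin (n + 1) → ℂ) :
    fderiv ℝ (lift (f : CP n → ℝ)) (c • x) (c • v) = fderiv ℝ (lift (f : CP n → ℝ)) x v := by
  have h1 : lift (f : CP n → ℝ) = fun y => lift (f : CP n → ℝ) (c • y) := by
    ext y
    rw [lift_smul _ hc]
  have h2 : HasFDerivAt (fun y : Fin (n + 1) → ℂ => c • y)
      ((c • ContinuousLinearMap.id ℂ (Fin (n + 1) → ℂ)).restrictScalars ℝ) x :=
    ((hasFDerivAt_id x).const_smul c).restrictScalars ℝ
  have h3 := (differentiableAt_lift f (smul_ne_zero hc hx)).hasFDerivAt.comp x h2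
  conv_rhs => rw [h1]
  rw [show (fun y => lift (f : CP n → ℝ) (c • y)) = lift (f : CP n → ℝ) ∘ fun y => c • y from rfl,
    h3.fderiv]
  rfl

theorem lift_mul {n : ℕ} (f g : CP n → ℝ) : lift (f * g) = fun x => lift f x * lift g x := by
  ext y
  by_cases h : y = 0 <;> simp [lift, h]

theorem lift_add {n : ℕ} (f g : CP n → ℝ) : lift (f + g) = fun x => lift f x + lift g x := by
  ext y
  by_cases h : y = 0 <;> simp [lift, h]

theorem lift_smulReal {n : ℕ} (r : ℝ) (f : CP n → ℝ) : lift (r • f) = fun x => r • lift f x := by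
  ext y
  by_cases h : y = 0 <;> simp [lift, h]

theorem contDiff_fderiv_lift {n : ℕ} (f : C n) (j : Fin (n + 1))
    {w : (Fin n → ℂ) → Fin (n + 1) → ℂ} (hw : ContDiff ℝ ∞ w) :
    ContDiff ℝ ∞ fun z => fderiv ℝ (lift (f : CP n → ℝ)) (affineVec j z) (w z) := by
  refine ContDiff.clm_apply ?_ hw
  refine contDiff_iff_contDiffAt.2 fun z => ?_
  exact ((contDiffAt_lift f (affineVec_ne_zero j z)).fderiv_right (m := ∞) (by simp)).comp z
    (contDiff_affineVec j).contDiffAt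

/-- The derivative of a smooth function `f` along a vector field `x ↦ v x` on `ℂⁿ⁺¹ ∖ {0}` that is
smooth and homogeneous of degree one. -/
def descendFun {n : ℕ} (v : (Fin (n + 1) → ℂ) → Fin (n + 1) → ℂ)
    (hv : ∀ j, ContDiff ℝ ∞ fun z => v (affineVec j z))
    (hv' : ∀ c : ℂ, c ≠ 0 → ∀ x, x ≠ 0 → v (c • x) = c • v x) (f : C n) : C n :=
  ⟨fun p => fderiv ℝ (lift (f : CP n → ℝ)) p.rep (v p.rep), fun j => by
    have : (fun z => fderiv ℝ (lift (f : CP n → ℝ)) (affineChart j z).rep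
        (v (affineChart j z).rep)) =
        fun z => fderiv ℝ (lift (f : CP n → ℝ)) (affineVec j z) (v (affineVec j z)) := by
      ext z
      obtain ⟨a, ha⟩ := Projectivization.exists_smul_eq_mk_rep ℂ (affineVec j z)
        (affineVec_ne_zero j z)
      rw [affineChart, ← ha, Units.smul_def, hv' _ a.ne_zero _ (affineVec_ne_zero j z),
        fderiv_lift_smul f a.ne_zero (affineVec_ne_zero j z)]
    rw [this]
    exact contDiff_fderiv_lift f j (hv j)⟩

theorem descendFun_apply {n : ℕ} (v : (Fin (n + 1) → ℂ) → Fin (n + 1) → ℂ)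
    (hv : ∀ j, ContDiff ℝ ∞ fun z => v (affineVec j z))
    (hv' : ∀ c : ℂ, c ≠ 0 → ∀ x, x ≠ 0 → v (c • x) = c • v x) (f : C n) (p : CP n) :
    (descendFun v hv hv' f : CP n → ℝ) p = fderiv ℝ (lift (f : CP n → ℝ)) p.rep (v p.rep) := rfl

/-- A vector field `x ↦ v x` on `ℂⁿ⁺¹ ∖ {0}` that is smooth and homogeneous of degree one
descends to projective space. -/
def descend {n : ℕ} (v : (Fin (n + 1) → ℂ) → Fin (n + 1) → ℂ)
    (hv : ∀ j, ContDiff ℝ ∞ fun z => v (affineVec j z))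
    (hv' : ∀ c : ℂ, c ≠ 0 → ∀ x, x ≠ 0 → v (c • x) = c • v x) : VectorField n where
  toFun := descendFun v hv hv'
  map_add' f g := by
    ext p
    have := fderiv_fun_add (differentiableAt_lift f p.rep_nonzero)
      (differentiableAt_lift g p.rep_nonzero)
    simp [descendFun_apply, lift_add, this]
  map_smul' r f := by
    ext p
    have := fderiv_fun_const_smul (differentiableAt_lift f p.rep_nonzero) r
    simp only [smul_eq_mul] at this
    simp [descendFun_apply, lift_smulReal, this]
  map_one_eq_zero' := by
    ext p
    have : lift (1 : CP n → ℝ) =ᶠ[nhds p.rep] fun _ => (1 : ℝ) := by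
      filter_upwards [isOpen_ne.mem_nhds p.rep_nonzero] with y hy
      rw [lift_of_ne _ hy]; rfl
    change (descendFun v hv hv' 1 : CP n → ℝ) p = 0
    simp [descendFun_apply, this.fderiv_eq]
  leibniz' f g := by
    ext p
    have := fderiv_fun_mul (differentiableAt_lift f p.rep_nonzero)
      (differentiableAt_lift g p.rep_nonzero)
    change (descendFun v hv hv' (f * g) : CP n → ℝ) p =
      (f : CP n → ℝ) p * (descendFun v hv hv' g : CP n → ℝ) p +
        (g : CP n → ℝ) p * (descendFun v hv hv' f : CP n → ℝ) p
    simp [descendFun_apply, lift_mul, this, lift_rep]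

theorem descend_apply {n : ℕ} (v : (Fin (n + 1) → ℂ) → Fin (n + 1) → ℂ)
    (hv : ∀ j, ContDiff ℝ ∞ fun z => v (affineVec j z))
    (hv' : ∀ c : ℂ, c ≠ 0 → ∀ x, x ≠ 0 → v (c • x) = c • v x) (f : C n) (p : CP n) :
    (descend v hv hv' f : CP n → ℝ) p = fderiv ℝ (lift (f : CP n → ℝ)) p.rep (v p.rep) := rfl

theorem descend_mk {n : ℕ} (v : (Fin (n + 1) → ℂ) → Fin (n + 1) → ℂ)
    (hv : ∀ j, ContDiff ℝ ∞ fun z => v (affineVec j z))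
    (hv' : ∀ c : ℂ, c ≠ 0 → ∀ x, x ≠ 0 → v (c • x) = c • v x) (f : C n)
    {x : Fin (n + 1) → ℂ} (hx : x ≠ 0) :
    (descend v hv hv' f : CP n → ℝ) (Projectivization.mk ℂ x hx) =
      fderiv ℝ (lift (f : CP n → ℝ)) x (v x) := by
  obtain ⟨a, ha⟩ := Projectivization.exists_smul_eq_mk_rep ℂ x hx
  change fderiv ℝ (lift (f : CP n → ℝ)) (Projectivization.mk ℂ x hx).rep
    (v (Projectivization.mk ℂ x hx).rep) = _
  rw [← ha, Units.smul_def, hv' _ a.ne_zero _ hx, fderiv_lift_smul f a.ne_zero hx]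

/-- The Wirtinger derivative `∂F/∂X_k = ½ (∂F/∂Re X_k - i ∂F/∂Im X_k)` of a real function. -/
def wirtinger {m : ℕ} (F : (Fin m → ℂ) → ℝ) (x : Fin m → ℂ) (k : Fin m) : ℂ :=
  (1 / 2 : ℂ) * ((fderiv ℝ F x (Pi.single k 1) : ℂ) - I * (fderiv ℝ F x (Pi.single k I) : ℂ))

theorem fderiv_single {m : ℕ} (L : (Fin m → ℂ) →L[ℝ] ℝ) (k : Fin m) (c : ℂ) :
    L (Pi.single k c) = c.re * L (Pi.single k 1) + c.im * L (Pi.single k I) := by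
  have : (Pi.single k c : Fin m → ℂ) =
      c.re • (Pi.single k 1 : Fin m → ℂ) + c.im • (Pi.single k I : Fin m → ℂ) := by
    rw [← Pi.single_smul, ← Pi.single_smul, ← Pi.single_add]
    simp
  rw [this, map_add, map_smul, map_smul, smul_eq_mul, smul_eq_mul]

theorem fderiv_eq_wirtinger {m : ℕ} (F : (Fin m → ℂ) → ℝ) (x v : Fin m → ℂ) :
    fderiv ℝ F x v = 2 * ∑ k, (wirtinger F x k * v k).re := by
  conv_lhs => rw [← Finset.univ_sum_single v]
  rw [map_sum, Finset.mul_sum]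
  refine Finset.sum_congr rfl fun k _ => ?_
  rw [fderiv_single]
  simp [wirtinger]
  ring

theorem wirtinger_lift_smul {n : ℕ} (f : C n) {c : ℂ} (hc : c ≠ 0) {x : Fin (n + 1) → ℂ}
    (hx : x ≠ 0) (k : Fin (n + 1)) :
    wirtinger (lift (f : CP n → ℝ)) (c • x) k =
      c⁻¹ * wirtinger (lift (f : CP n → ℝ)) x k := by
  have h : ∀ d : ℂ, fderiv ℝ (lift (f : CP n → ℝ)) (c • x) (Pi.single k d) =
      fderiv ℝ (lift (f : CP n → ℝ)) x (Pi.single k (c⁻¹ * d)) := fun d => by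
    rw [← fderiv_lift_smul f hc hx, ← Pi.single_smul]
    simp [hc]
  rw [wirtinger, wirtinger, h, h, fderiv_single _ k (c⁻¹ * 1), fderiv_single _ k (c⁻¹ * I)]
  generalize c⁻¹ = b
  apply Complex.ext <;> simp <;> ring

theorem contDiff_wirtinger_lift {n : ℕ} (f : C n) (j k : Fin (n + 1)) :
    ContDiff ℝ ∞ fun z => wirtinger (lift (f : CP n → ℝ)) (affineVec j z) k := by
  unfold wirtinger
  refine contDiff_const.mul (ContDiff.sub ?_ (contDiff_const.mul ?_))
  · exact Complex.ofRealCLM.contDiff.comp (contDiff_fderiv_lift f j contDiff_const)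
  · exact Complex.ofRealCLM.contDiff.comp (contDiff_fderiv_lift f j contDiff_const)

theorem wirtinger_lift_add {n : ℕ} (f g : C n) {x : Fin (n + 1) → ℂ} (hx : x ≠ 0)
    (k : Fin (n + 1)) : wirtinger (lift ((f : CP n → ℝ) + (g : CP n → ℝ))) x k =
      wirtinger (lift (f : CP n → ℝ)) x k + wirtinger (lift (g : CP n → ℝ)) x k := by
  have := fderiv_fun_add (differentiableAt_lift f hx) (differentiableAt_lift g hx)
  simp [wirtinger, lift_add, this]
  ring

theorem wirtinger_lift_smulReal {n : ℕ} (r : ℝ) (f : C n) {x : Fin (n + 1) → ℂ} (hx : x ≠ 0)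
    (k : Fin (n + 1)) : wirtinger (lift (r • (f : CP n → ℝ))) x k =
      r * wirtinger (lift (f : CP n → ℝ)) x k := by
  have := fderiv_fun_const_smul (differentiableAt_lift f hx) r
  simp only [smul_eq_mul] at this
  simp [wirtinger, lift_smulReal, this]
  ring

/-- Bivector fields, given by `f ↦ {f, ·}` (where `{f, g} = π(df, dg)`). -/
abbrev BivectorField (n : ℕ) : Type := C n →ₗ[ℝ] VectorField n

/-- A real-linear contraction `Y x : α ↦ Y x α` of differentials on `ℂⁿ⁺¹ ∖ {0}` (a differential
`dF` being given by its coefficients `α_k = ∂F/∂X_k`) that depends smoothly on `x` and is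
compatible with scaling descends to a bivector field on projective space. -/
def descendBivector {n : ℕ} (Y : (Fin (n + 1) → ℂ) → (Fin (n + 1) → ℂ) → Fin (n + 1) → ℂ)
    (hadd : ∀ x α β, Y x (α + β) = Y x α + Y x β)
    (hsmul : ∀ x (r : ℝ) α, Y x (r • α) = r • Y x α)
    (hscale : ∀ c : ℂ, c ≠ 0 → ∀ x α, Y (c • x) (c⁻¹ • α) = c • Y x α)
    (hsmooth : ContDiff ℝ ∞ fun q : (Fin (n + 1) → ℂ) × (Fin (n + 1) → ℂ) => Y q.1 q.2) :
    BivectorField n where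
  toFun f := descend (fun x => Y x (wirtinger (lift (f : CP n → ℝ)) x))
    (fun j => hsmooth.comp ((contDiff_affineVec j).prodMk
      (contDiff_pi.2 fun k => contDiff_wirtinger_lift f j k)))
    (fun c hc x hx => by
      rw [← hscale c hc]
      congr 1
      ext k
      simp [wirtinger_lift_smul f hc hx])
  map_add' f g := by
    ext h p
    have : wirtinger (lift ((f : CP n → ℝ) + (g : CP n → ℝ))) p.rep =
        wirtinger (lift (f : CP n → ℝ)) p.rep + wirtinger (lift (g : CP n → ℝ)) p.rep :=
      funext (wirtinger_lift_add f g p.rep_nonzero)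
    simp [descend_apply, this, hadd]
  map_smul' r f := by
    ext h p
    have : wirtinger (lift (r • (f : CP n → ℝ))) p.rep =
        r • wirtinger (lift (f : CP n → ℝ)) p.rep :=
      funext fun k => by simp [wirtinger_lift_smulReal r f p.rep_nonzero]
    simp [descend_apply, this, hsmul]

theorem descendBivector_mk {n : ℕ}
    (Y : (Fin (n + 1) → ℂ) → (Fin (n + 1) → ℂ) → Fin (n + 1) → ℂ)
    (hadd : ∀ x α β, Y x (α + β) = Y x α + Y x β)
    (hsmul : ∀ x (r : ℝ) α, Y x (r • α) = r • Y x α)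
    (hscale : ∀ c : ℂ, c ≠ 0 → ∀ x α, Y (c • x) (c⁻¹ • α) = c • Y x α)
    (hsmooth : ContDiff ℝ ∞ fun q : (Fin (n + 1) → ℂ) × (Fin (n + 1) → ℂ) => Y q.1 q.2)
    (f g : C n) {x : Fin (n + 1) → ℂ} (hx : x ≠ 0) :
    (descendBivector Y hadd hsmul hscale hsmooth f g : CP n → ℝ) (Projectivization.mk ℂ x hx) =
      2 * ∑ k, (wirtinger (lift (g : CP n → ℝ)) x k *
        Y x (wirtinger (lift (f : CP n → ℝ)) x) k).re := by
  rw [← fderiv_eq_wirtinger]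
  exact descend_mk _ _ _ g hx

/-- Contraction of a differential (in the first slot) with the bivector
`i |X|² ∑_k ∂̄_k ∧ ∂_k` on `ℂⁿ⁺¹ ∖ {0}`. -/
def fubiniStudySharp {n : ℕ} (x α : Fin (n + 1) → ℂ) (k : Fin (n + 1)) : ℂ :=
  I * (∑ l, Complex.normSq (x l) : ℝ) * conj (α k)

/-- Contraction of a differential (in the first slot) with the bivector
`Re (-i ∑_{k<l} X_k X_l ∂_k ∧ ∂_l) + i ∑_k (|X_k|²/2 + ∑_{l>k} |X_l|²) ∂_k ∧ ∂̄_k`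
on `ℂⁿ⁺¹ ∖ {0}`. -/
def bruhatSharp {n : ℕ} (x α : Fin (n + 1) → ℂ) (k : Fin (n + 1)) : ℂ :=
  (I / 2) * ((∑ l with k < l, x l * x k * α l) - ∑ l with l < k, x l * x k * α l) -
    I * (Complex.normSq (x k) / 2 + ∑ l with k < l, Complex.normSq (x l) : ℝ) * conj (α k)

theorem contDiff_normSq' {E : Type*} [NormedAddCommGroup E] [NormedSpace ℝ E] {f : E → ℂ}
    (hf : ContDiff ℝ ∞ f) : ContDiff ℝ ∞ fun x => Complex.normSq (f x) := by
  simp only [Complex.normSq_apply]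
  have h1 : ContDiff ℝ ∞ fun x => (f x).re := Complex.reCLM.contDiff.comp hf
  have h2 : ContDiff ℝ ∞ fun x => (f x).im := Complex.imCLM.contDiff.comp hf
  exact (h1.mul h1).add (h2.mul h2)

/-- The bivector field `π_λ`, the inverse of the Fubini-Study form (see
`fubiniStudyForm_fubiniStudy`). -/
def fubiniStudy (n : ℕ) : BivectorField n :=
  descendBivector fubiniStudySharp
    (fun x α β => by ext k; simp [fubiniStudySharp]; ring)
    (fun x r α => by ext k; simp [fubiniStudySharp]; ring)
    (fun c hc x α => by
      ext k
      have h : (Complex.normSq c : ℂ) = c * conj c := (Complex.mul_conj c).symm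
      have hc' : conj c ≠ 0 := (map_ne_zero _).2 hc
      simp only [fubiniStudySharp, Pi.smul_apply, smul_eq_mul, map_mul, ← Finset.mul_sum,
        Complex.ofReal_mul, h, map_inv₀]
      field_simp)
    (contDiff_pi.2 fun k => by
      have hx : ∀ l, ContDiff ℝ ∞ fun q : (Fin (n + 1) → ℂ) × (Fin (n + 1) → ℂ) => q.1 l :=
        fun l => (contDiff_apply ℝ ℂ l).comp contDiff_fst
      have ha : ∀ l, ContDiff ℝ ∞ fun q : (Fin (n + 1) → ℂ) × (Fin (n + 1) → ℂ) => q.2 l :=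
        fun l => (contDiff_apply ℝ ℂ l).comp contDiff_snd
      unfold fubiniStudySharp
      refine (contDiff_const.mul (Complex.ofRealCLM.contDiff.comp ?_)).mul
        (Complex.conjCLE.contDiff.comp (ha k))
      exact ContDiff.sum (s := Finset.univ) fun l _ => contDiff_normSq' (hx l))

/-- The Bruhat-Poisson bivector field `π₀` (see `bruhat_luChart`). -/
def bruhat (n : ℕ) : BivectorField n :=
  descendBivector bruhatSharp
    (fun x α β => by
      ext k
      simp only [bruhatSharp, Pi.add_apply, mul_add, Finset.sum_add_distrib, map_add]
      ring)
    (fun x r α => by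
      ext k
      simp only [bruhatSharp, Pi.smul_apply, Complex.real_smul, map_mul, Complex.conj_ofReal,
        mul_left_comm _ (r : ℂ), ← Finset.mul_sum]
      ring)
    (fun c hc x α => by
      ext k
      have h : (Complex.normSq c : ℂ) = c * conj c := (Complex.mul_conj c).symm
      have hc' : conj c ≠ 0 := (map_ne_zero _).2 hc
      have e : ∀ l, c * x l * (c * x k) * (c⁻¹ * α l) = c * (x l * x k * α l) := fun l => by
        field_simp
      simp only [bruhatSharp, Pi.smul_apply, smul_eq_mul, map_mul, e, ← Finset.mul_sum,
        mul_div_assoc, ← mul_add, Complex.ofReal_mul, h, map_inv₀]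
      generalize (∑ l with k < l, x l * x k * α l) = A
      generalize (∑ l with l < k, x l * x k * α l) = B
      field_simp)
    (contDiff_pi.2 fun k => by
      have hx : ∀ l, ContDiff ℝ ∞ fun q : (Fin (n + 1) → ℂ) × (Fin (n + 1) → ℂ) => q.1 l :=
        fun l => (contDiff_apply ℝ ℂ l).comp contDiff_fst
      have ha : ∀ l, ContDiff ℝ ∞ fun q : (Fin (n + 1) → ℂ) × (Fin (n + 1) → ℂ) => q.2 l :=
        fun l => (contDiff_apply ℝ ℂ l).comp contDiff_snd
      unfold bruhatSharp
      refine (contDiff_const.mul (ContDiff.sub ?_ ?_)).sub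
        ((contDiff_const.mul (Complex.ofRealCLM.contDiff.comp ?_)).mul
        (Complex.conjCLE.contDiff.comp (ha k)))
      · exact ContDiff.sum fun l _ => ((hx l).mul (hx k)).mul (ha l)
      · exact ContDiff.sum fun l _ => ((hx l).mul (hx k)).mul (ha l)
      · exact ((contDiff_normSq' (hx k)).div_const 2).add
          (ContDiff.sum fun l _ => contDiff_normSq' (hx l)))

/-- The pencil `π_t = π₀ + t π_λ`. -/
def pencil (n : ℕ) (t : ℝ) : BivectorField n := bruhat n + t • fubiniStudy n

/-- The infinitesimal action of a matrix `H` on projective space (from the right, a point being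
the class of a row vector): the vector field induced by `X ↦ X H`. -/
def fundamental {n : ℕ} (H : Matrix (Fin (n + 1)) (Fin (n + 1)) ℂ) : VectorField n :=
  descend (fun x => Matrix.vecMul x H)
    (fun j => contDiff_pi.2 fun k => by
      simp only [Matrix.vecMul, dotProduct]
      exact ContDiff.sum fun l _ => ((contDiff_apply ℝ ℂ l).comp (contDiff_affineVec j)).mul
        contDiff_const)
    (fun c _ x _ => Matrix.smul_vecMul c x H)

open scoped Matrix.Norms.Operator in
/-- The vector field `fundamental H` generates the one-parameter group `[X] ↦ [X exp(sH)]`. -/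
theorem fundamental_mk {n : ℕ} (H : Matrix (Fin (n + 1)) (Fin (n + 1)) ℂ) (f : C n)
    {x : Fin (n + 1) → ℂ} (hx : x ≠ 0) :
    (fundamental H f : CP n → ℝ) (Projectivization.mk ℂ x hx) =
      deriv (fun s : ℝ => lift (f : CP n → ℝ) (Matrix.vecMul x (NormedSpace.exp (s • H)))) 0 := by
  rw [fundamental, descend_mk]
  have h1 : HasDerivAt (fun s : ℝ => NormedSpace.exp (s • H)) H 0 := by
    have h0 := hasDerivAt_exp_smul_const (𝕂 := ℝ) H (0 : ℝ)
    rw [zero_smul, NormedSpace.exp_zero, one_mul] at h0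
    exact h0
  have h2 : HasDerivAt (fun s : ℝ => Matrix.vecMul x (NormedSpace.exp (s • H)))
      (Matrix.vecMul x H) 0 := by
    have := ((Matrix.vecMulBilin ℝ ℝ x).toContinuousLinearMap).hasFDerivAt.comp_hasDerivAt (0 : ℝ) h1
    exact this
  have h3 : HasFDerivAt (lift (f : CP n → ℝ)) (fderiv ℝ (lift (f : CP n → ℝ)) x)
      (Matrix.vecMul x (NormedSpace.exp ((0 : ℝ) • H))) := by
    simpa using (differentiableAt_lift f hx).hasFDerivAt
  exact (h3.comp_hasDerivAt (0 : ℝ) h2).deriv.symm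

/-- The element `H_k` of the Cartan subalgebra, `k = 1, …, n` (here `k` is the index plus one):
`H_k = i/(n+1) diag (n+1-k, …, n+1-k, -k, …, -k)` with `k` entries `n+1-k`. -/
def cartan (n : ℕ) (k : Fin n) : Matrix (Fin (n + 1)) (Fin (n + 1)) ℂ :=
  (I / (n + 1)) • Matrix.diagonal fun l : Fin (n + 1) =>
    if (l : ℕ) < k + 1 then ((n : ℂ) + 1 - (k + 1)) else -(k + 1)

/-- `i` times the half-sum of the positive roots `ε_a - ε_b`, `a < b`, the functional `ε_a` being
identified with the matrix unit `E_{aa}`. -/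
def halfSumPositiveRoots (n : ℕ) : Matrix (Fin (n + 1)) (Fin (n + 1)) ℂ :=
  (I / 2) • ∑ a : Fin (n + 1), ∑ b with a < b,
    (Matrix.single a a (1 : ℂ) - Matrix.single b b (1 : ℂ))

/-- `ξ` represents the vector field `X` in the `j`-th affine chart. -/
def Represents {n : ℕ} (X : VectorField n) (j : Fin (n + 1)) (ξ : (Fin n → ℂ) → Fin n → ℂ) :
    Prop :=
  ContDiff ℝ ∞ ξ ∧ ∀ (f : C n) (z : Fin n → ℂ),
    (X f : CP n → ℝ) (affineChart j z) =
      fderiv ℝ (fun w => (f : CP n → ℝ) (affineChart j w)) z (ξ z)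

/-- The Fubini-Study symplectic form `ω_λ = -i ∂∂̄ log (1 + |z|²)` in an affine chart. -/
def fubiniStudyForm {n : ℕ} (z u v : Fin n → ℂ) : ℝ :=
  2 * ((1 + ∑ a, Complex.normSq (z a) : ℝ) * (∑ a, u a * conj (v a)) -
    (∑ a, u a * conj (z a)) * ∑ a, z a * conj (v a)).im / (1 + ∑ a, Complex.normSq (z a)) ^ 2

theorem fderiv_lift_euler {n : ℕ} (f : C n) {x : Fin (n + 1) → ℂ} (hx : x ≠ 0) (c : ℂ) :
    fderiv ℝ (lift (f : CP n → ℝ)) x (c • x) = 0 := by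
  have h2 : HasDerivAt (fun s : ℝ => (1 + s * c) • x) (c • x) 0 := by
    have : HasDerivAt (fun s : ℝ => (1 + (s : ℂ) * c)) c 0 := by
      simpa using ((Complex.ofRealCLM.hasDerivAt (x := (0 : ℝ))).mul_const c).const_add 1
    exact this.smul_const x
  have h3 : HasFDerivAt (lift (f : CP n → ℝ)) (fderiv ℝ (lift (f : CP n → ℝ)) x)
      ((1 + ((0 : ℝ) : ℂ) * c) • x) := by
    simpa using (differentiableAt_lift f hx).hasFDerivAt
  have h4 := (h3.comp_hasDerivAt (0 : ℝ) h2).deriv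
  rw [← h4]
  have h5 : ∀ᶠ s : ℝ in nhds 0, (1 + (s : ℂ) * c) ≠ 0 := by
    have : ContinuousAt (fun s : ℝ => (1 + (s : ℂ) * c)) 0 := by fun_prop
    exact this.eventually_ne (by simp)
  have h6 : (lift (f : CP n → ℝ) ∘ fun s : ℝ => (1 + s * c) • x) =ᶠ[nhds 0]
      fun _ => lift (f : CP n → ℝ) x := by
    filter_upwards [h5] with s hs
    exact lift_smul _ hs x
  rw [h6.deriv_eq]
  simp

/-- Euler's relation. -/
theorem sum_wirtinger_lift {n : ℕ} (f : C n) {x : Fin (n + 1) → ℂ} (hx : x ≠ 0) :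
    ∑ k, x k * wirtinger (lift (f : CP n → ℝ)) x k = 0 := by
  have h1 := fderiv_lift_euler f hx 1
  have h2 := fderiv_lift_euler f hx I
  rw [fderiv_eq_wirtinger] at h1 h2
  apply Complex.ext
  · rw [Complex.re_sum]
    simpa [mul_comm] using h1
  · rw [Complex.im_sum]
    have h3 : ∑ k, (wirtinger (lift (f : CP n → ℝ)) x k * (I • x) k).re =
        -∑ k, (x k * wirtinger (lift (f : CP n → ℝ)) x k).im := by
      rw [← Finset.sum_neg_distrib]
      refine Finset.sum_congr rfl fun k _ => ?_
      simp
      ring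
    rw [h3] at h2
    simpa using h2

theorem hasFDerivAt_comp_affineChart {n : ℕ} (f : C n) (j : Fin (n + 1)) (z u : Fin n → ℂ) :
    fderiv ℝ (fun w => (f : CP n → ℝ) (affineChart j w)) z u =
      fderiv ℝ (lift (f : CP n → ℝ)) (affineVec j z)
        (j.insertNth (α := fun _ => ℂ) 0 u) := by
  have h1 : HasFDerivAt (affineVec j : (Fin n → ℂ) → _)
      (fderiv ℝ (affineVec j : (Fin n → ℂ) → _) z) z :=
    ((contDiff_affineVec j).differentiable (by simp) z).hasFDerivAt
  have h2 := (differentiableAt_lift f (affineVec_ne_zero j z)).hasFDerivAt.comp z h1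
  have h3 : (lift (f : CP n → ℝ) ∘ affineVec j) =
      fun w => (f : CP n → ℝ) (affineChart j w) := funext fun w => lift_affineVec _ j w
  rw [h3] at h2
  rw [h2.fderiv, ContinuousLinearMap.comp_apply]
  congr 1
  ext k
  have h4 := hasFDerivAt_pi'.1 h1 k
  rw [← ContinuousLinearMap.proj_apply (R := ℝ) (φ := fun _ : Fin (n + 1) => ℂ) k
    (fderiv ℝ (affineVec j) z u), ← ContinuousLinearMap.comp_apply]
  rcases Fin.eq_self_or_eq_succAbove j k with rfl | ⟨a, rfl⟩
  · simp only [affineVec_same] at h4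
    rw [h4.unique (hasFDerivAt_const _ _)]
    simp
  · simp only [affineVec_succAbove] at h4
    rw [h4.unique (hasFDerivAt_apply a z)]
    simp

theorem represents_descend {n : ℕ} (v : (Fin (n + 1) → ℂ) → Fin (n + 1) → ℂ)
    (hv : ∀ j, ContDiff ℝ ∞ fun z => v (affineVec j z))
    (hv' : ∀ c : ℂ, c ≠ 0 → ∀ x, x ≠ 0 → v (c • x) = c • v x) (j : Fin (n + 1)) :
    Represents (descend v hv hv') j fun z a =>
      v (affineVec j z) (j.succAbove a) - v (affineVec j z) j * z a := by
  refine ⟨contDiff_pi.2 fun a => ?_, fun f z => ?_⟩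
  · have h := contDiff_pi.1 (hv j)
    exact (h _).sub ((h _).mul (contDiff_apply ℝ ℂ a))
  · rw [hasFDerivAt_comp_affineChart, affineChart, descend_mk]
    have : v (affineVec j z) = j.insertNth (α := fun _ => ℂ) 0 (fun a =>
        v (affineVec j z) (j.succAbove a) - v (affineVec j z) j * z a) +
          v (affineVec j z) j • affineVec j z := by
      ext k
      rcases Fin.eq_self_or_eq_succAbove j k with rfl | ⟨a, rfl⟩ <;> simp
    conv_lhs => rw [this]
    rw [map_add, fderiv_lift_euler f (affineVec_ne_zero j z), add_zero]

/-- The vector field `{f, ·}` of `π_λ` is the Hamiltonian vector field `ω_λ(X_f, ·) = df`: the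
bivector `π_λ` is the inverse of `ω_λ`. -/
theorem fubiniStudyForm_fubiniStudy {n : ℕ} (f : C n) (j : Fin (n + 1)) :
    ∃ ξ, Represents (fubiniStudy n f) j ξ ∧ ∀ z v, fubiniStudyForm z (ξ z) v =
      fderiv ℝ (fun w => (f : CP n → ℝ) (affineChart j w)) z v := by
  refine ⟨_, represents_descend _ _ _ j, fun z v => ?_⟩
  rw [hasFDerivAt_comp_affineChart, fderiv_eq_wirtinger]
  have he := sum_wirtinger_lift f (affineVec_ne_zero j z)
  set α := wirtinger (lift (f : CP n → ℝ)) (affineVec j z) with hα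
  rw [Fin.sum_univ_succAbove _ j] at he ⊢
  simp only [affineVec_same, affineVec_succAbove, one_mul, Fin.insertNth_apply_same,
    Fin.insertNth_apply_succAbove, mul_zero, Complex.zero_re, zero_add] at he ⊢
  have hN : ∑ l, Complex.normSq (affineVec j z l) = 1 + ∑ a, Complex.normSq (z a) := by
    rw [Fin.sum_univ_succAbove _ j]
    simp
  have hpos : 0 < 1 + ∑ a, Complex.normSq (z a) := by
    have := Finset.sum_nonneg fun a (_ : a ∈ Finset.univ) => Complex.normSq_nonneg (z a)
    linarith
  have hz : ∑ a, z a * conj (z a) = ((∑ a, Complex.normSq (z a) : ℝ) : ℂ) := by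
    rw [Complex.ofReal_sum]
    exact Finset.sum_congr rfl fun a _ => Complex.mul_conj _
  simp only [fubiniStudyForm, fubiniStudySharp, hN]
  set N : ℝ := 1 + ∑ a, Complex.normSq (z a) with hNdef
  have hN' : ((∑ a, Complex.normSq (z a) : ℝ) : ℂ) = N - 1 := by
    rw [hNdef]
    push_cast
    ring
  have he' : conj (α j) = -∑ a, conj (z a) * conj (α (j.succAbove a)) := by
    have := congrArg conj (eq_neg_of_add_eq_zero_left he)
    simpa using this
  have e1 : ∑ a, (I * N * conj (α (j.succAbove a)) - I * N * conj (α j) * z a) * conj (v a) =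
      I * N * (∑ a, conj (α (j.succAbove a)) * conj (v a)) -
        I * N * conj (α j) * ∑ a, z a * conj (v a) := by
    rw [Finset.mul_sum, Finset.mul_sum, ← Finset.sum_sub_distrib]
    exact Finset.sum_congr rfl fun a _ => by ring
  have e2 : ∑ a, (I * N * conj (α (j.succAbove a)) - I * N * conj (α j) * z a) * conj (z a) =
      -(I * N * N * conj (α j)) := by
    have : ∑ a, (I * N * conj (α (j.succAbove a)) - I * N * conj (α j) * z a) * conj (z a) =
        I * N * (∑ a, conj (z a) * conj (α (j.succAbove a))) -
          I * N * conj (α j) * ∑ a, z a * conj (z a) := by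
      rw [Finset.mul_sum, Finset.mul_sum, ← Finset.sum_sub_distrib]
      exact Finset.sum_congr rfl fun a _ => by ring
    rw [this, hz, hN', he']
    ring
  rw [e1, e2]
  have e3 : (N : ℂ) * (I * N * (∑ a, conj (α (j.succAbove a)) * conj (v a)) -
        I * N * conj (α j) * ∑ a, z a * conj (v a)) -
        -(I * N * N * conj (α j)) * ∑ a, z a * conj (v a) =
      ((N ^ 2 : ℝ) : ℂ) * (I * conj (∑ a, α (j.succAbove a) * v a)) := by
    simp only [map_sum, map_mul]
    push_cast
    ring
  rw [e3, Complex.im_ofReal_mul, ← Complex.re_sum]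
  have : (I * conj (∑ a, α (j.succAbove a) * v a)).im = (∑ a, α (j.succAbove a) * v a).re := by
    simp
  rw [this]
  field_simp

/-- The vector with entries `z_i = y_i (∏_{j>i} (1 + |y_j|²))^{1/2}`, that is,
`y_i = z_i / (1 + ∑_{j>i} |z_j|²)^{1/2}`. -/
def luPoint {n : ℕ} (y : Fin n → ℂ) (i : Fin n) : ℂ :=
  y i * (Real.sqrt (∏ j with i < j, (1 + Complex.normSq (y j))) : ℝ)

/-- Lu's coordinates on the cell `X_{n+1} ≠ 0`. -/
def luChart {n : ℕ} (y : Fin n → ℂ) : CP n := affineChart (Fin.last n) (luPoint y)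

theorem prod_one_add_ordered_gt {n : ℕ} (r : Fin n → ℝ) (s : Finset (Fin n)) :
    ∏ i ∈ s, (1 + r i) = 1 + ∑ i ∈ s, r i * ∏ j ∈ s with i < j, (1 + r j) := by
  induction s using Finset.induction_on_min with
  | empty => simp
  | insert a s ha ih =>
    have has : a ∉ s := fun h => lt_irrefl a (ha a h)
    have h1 : (insert a s).filter (fun j => a < j) = s := by
      ext j
      simp only [Finset.mem_filter, Finset.mem_insert]
      constructor
      · rintro ⟨rfl | h, h'⟩
        · exact absurd h' (lt_irrefl _)
        · exact h
      · exact fun h => ⟨Or.inr h, ha j h⟩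
    have h2 : ∀ i ∈ s, (insert a s).filter (fun j => i < j) = s.filter (fun j => i < j) :=
      fun i hi => by rw [Finset.filter_insert, if_neg (ha i hi).not_gt]
    rw [Finset.prod_insert has, Finset.sum_insert has, h1,
      Finset.sum_congr rfl fun i hi => by rw [h2 i hi], add_mul, ih]
    ring

theorem luFactor_pos {n : ℕ} (y : Fin n → ℂ) (i : Fin n) :
    0 < ∏ j with i < j, (1 + Complex.normSq (y j)) :=
  Finset.prod_pos fun k _ => by have := Complex.normSq_nonneg (y k); linarith

theorem luFactor_eq {n : ℕ} (y : Fin n → ℂ) (i : Fin n) :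
    1 + ∑ j with i < j, Complex.normSq (luPoint y j) =
      ∏ j with i < j, (1 + Complex.normSq (y j)) := by
  rw [prod_one_add_ordered_gt (fun j => Complex.normSq (y j)) {j | i < j}]
  congr 1
  refine Finset.sum_congr rfl fun j hj => ?_
  have hij : i < j := by simpa using hj
  rw [luPoint, Complex.normSq_mul, Complex.normSq_ofReal,
    Real.mul_self_sqrt (luFactor_pos y j).le]
  congr 1
  refine Finset.prod_congr ?_ fun _ _ => rfl
  ext k
  simp only [Finset.mem_filter, Finset.mem_univ, true_and]
  exact ⟨fun h => ⟨hij.trans h, h⟩, fun h => h.2⟩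

/-- `y_i = z_i / (1 + ∑_{j>i} |z_j|²)^{1/2}` for `z = luPoint y`. -/
theorem luPoint_spec {n : ℕ} (y : Fin n → ℂ) (i : Fin n) :
    y i = luPoint y i / (Real.sqrt (1 + ∑ j with i < j, Complex.normSq (luPoint y j)) : ℝ) := by
  rw [luFactor_eq, luPoint]
  have : ((Real.sqrt (∏ j with i < j, (1 + Complex.normSq (y j))) : ℝ) : ℂ) ≠ 0 := by
    exact_mod_cast (Real.sqrt_pos.2 (luFactor_pos y i)).ne'
  field_simp

theorem contDiff_luPoint {n : ℕ} : ContDiff ℝ ∞ (luPoint : (Fin n → ℂ) → Fin n → ℂ) := by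
  refine contDiff_pi.2 fun i => (contDiff_apply ℝ ℂ i).mul (Complex.ofRealCLM.contDiff.comp ?_)
  refine ContDiff.sqrt (contDiff_prod fun j _ => contDiff_const.add
    (contDiff_normSq' (contDiff_apply ℝ ℂ j))) fun y => (luFactor_pos y i).ne'

theorem hasDerivAt_luPoint {n : ℕ} (y : Fin n → ℂ) (k : Fin n) (c : ℂ) (i : Fin n) :
    HasDerivAt (fun s : ℝ => luPoint (y + s • (Pi.single k c : Fin n → ℂ)) i)
      (if i < k then luPoint y i * ((conj (y k) * c).re / (1 + Complex.normSq (y k)) : ℝ)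
        else if i = k then c * (Real.sqrt (∏ j with i < j, (1 + Complex.normSq (y j))) : ℝ)
        else 0) 0 := by
  have hne : ∀ j, j ≠ k → ∀ s : ℝ, (y + s • (Pi.single k c : Fin n → ℂ)) j = y j := fun j hj s => by
    simp [hj]
  by_cases hik : i < k
  · rw [if_pos hik]
    have hq : HasDerivAt (fun s : ℝ => 1 + Complex.normSq (y k + s * c))
        (2 * (conj (y k) * c).re) 0 := by
      have h1 : HasDerivAt (fun s : ℝ => ((y k).re + s * c.re)) c.re 0 := by
        simpa using ((hasDerivAt_id (0 : ℝ)).mul_const c.re).const_add (y k).re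
      have h2 : HasDerivAt (fun s : ℝ => ((y k).im + s * c.im)) c.im 0 := by
        simpa using ((hasDerivAt_id (0 : ℝ)).mul_const c.im).const_add (y k).im
      have h3 := ((h1.mul h1).add (h2.mul h2)).const_add 1
      refine (h3.congr_deriv ?_).congr_of_eventuallyEq (Filter.Eventually.of_forall fun s => ?_)
      · simp
        ring
      · simp [Complex.normSq_apply]
    have hmem : k ∈ ({j | i < j} : Finset (Fin n)) := by simpa using hik
    set R := ∏ j ∈ ({j | i < j} : Finset (Fin n)).erase k, (1 + Complex.normSq (y j)) with hR
    have hP : ∀ s : ℝ, ∏ j with i < j,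
        (1 + Complex.normSq ((y + s • (Pi.single k c : Fin n → ℂ)) j)) =
          (1 + Complex.normSq (y k + s * c)) * R := fun s => by
      rw [← Finset.mul_prod_erase _ _ hmem, hR]
      congr 1
      · simp
      · exact Finset.prod_congr rfl fun j hj => by rw [hne j (Finset.ne_of_mem_erase hj)]
    have hP0 : ∏ j with i < j, (1 + Complex.normSq (y j)) = (1 + Complex.normSq (y k)) * R := by
      simpa using hP 0
    have hpos := luFactor_pos y i
    have hq0 : 0 < 1 + Complex.normSq (y k) := by have := Complex.normSq_nonneg (y k); linarith
    have hs := ((hq.mul_const R).sqrt (by simpa [← hP0] using hpos.ne')).ofReal_comp.const_mul (y i)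
    have e : (fun s : ℝ => luPoint (y + s • (Pi.single k c : Fin n → ℂ)) i) = fun s : ℝ =>
        y i * (Real.sqrt ((1 + Complex.normSq (y k + s * c)) * R) : ℝ) := by
      ext s
      rw [luPoint, hP, hne i hik.ne]
    rw [e]
    refine hs.congr_deriv ?_
    have e0 : (1 + Complex.normSq (y k + (0 : ℝ) * c)) * R =
        ∏ j with i < j, (1 + Complex.normSq (y j)) := by simp [hP0]
    rw [luPoint, e0, mul_assoc (y i), ← Complex.ofReal_mul]
    congr 2
    have hsq := Real.mul_self_sqrt hpos.le
    have hs0 := Real.sqrt_pos.2 hpos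
    set S := Real.sqrt (∏ j with i < j, (1 + Complex.normSq (y j)))
    have : R = S * S / (1 + Complex.normSq (y k)) := by
      rw [hsq, hP0]
      field_simp
    rw [this]
    field_simp
  · rw [if_neg hik]
    have e : (fun s : ℝ => luPoint (y + s • (Pi.single k c : Fin n → ℂ)) i) = fun s : ℝ =>
        (y + s • (Pi.single k c : Fin n → ℂ)) i *
          (Real.sqrt (∏ j with i < j, (1 + Complex.normSq (y j))) : ℝ) := by
      ext s
      rw [luPoint]
      congr 3
      refine Finset.prod_congr rfl fun j hj => ?_
      have hij : i < j := by simpa using hj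
      rw [hne j]
      rintro rfl
      exact hik hij
    rw [e]
    by_cases h : i = k
    · subst h
      rw [if_pos rfl]
      refine HasDerivAt.mul_const ?_ _
      have := ((Complex.ofRealCLM.hasDerivAt (x := (0 : ℝ))).mul_const c).const_add (y i)
      simpa using this
    · rw [if_neg h]
      simp only [hne i h]
      exact hasDerivAt_const _ _

theorem wirtinger_luChart {n : ℕ} (f : C n) (y : Fin n → ℂ) (k : Fin n) :
    wirtinger (fun w => (f : CP n → ℝ) (luChart w)) y k =
      (Real.sqrt (∏ j with k < j, (1 + Complex.normSq (y j))) : ℝ) *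
        wirtinger (lift (f : CP n → ℝ)) (affineVec (Fin.last n) (luPoint y)) k.castSucc +
      conj (y k) / (1 + Complex.normSq (y k) : ℝ) *
        ((∑ i with i < k, (luPoint y i *
          wirtinger (lift (f : CP n → ℝ)) (affineVec (Fin.last n) (luPoint y)) i.castSucc).re :
            ℝ) : ℂ) := by
  set x := affineVec (Fin.last n) (luPoint y) with hx
  have hd : ∀ c : ℂ, fderiv ℝ (fun w => (f : CP n → ℝ) (luChart w)) y (Pi.single k c) =
      2 * ((∑ i with i < k, (luPoint y i * wirtinger (lift (f : CP n → ℝ)) x i.castSucc).re) *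
        ((conj (y k) * c).re / (1 + Complex.normSq (y k))) +
        (Real.sqrt (∏ j with k < j, (1 + Complex.normSq (y j)))) *
          (wirtinger (lift (f : CP n → ℝ)) x k.castSucc * c).re) := fun c => by
    have h1 : DifferentiableAt ℝ (fun w => (f : CP n → ℝ) (luChart w)) y :=
      ((f.2 (Fin.last n)).comp contDiff_luPoint).differentiable (by simp) y
    have h2 : HasDerivAt (fun s : ℝ => y + s • (Pi.single k c : Fin n → ℂ)) (Pi.single k c) 0 := by
      simpa using ((hasDerivAt_id (0 : ℝ)).smul_const (Pi.single k c : Fin n → ℂ)).const_add y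
    have h3 : HasFDerivAt (fun w => (f : CP n → ℝ) (luChart w))
        (fderiv ℝ (fun w => (f : CP n → ℝ) (luChart w)) y)
        (y + (0 : ℝ) • (Pi.single k c : Fin n → ℂ)) := by
      simpa using h1.hasFDerivAt
    have h4 := h3.comp_hasDerivAt (0 : ℝ) h2
    have h5 : HasDerivAt (fun s : ℝ => luPoint (y + s • (Pi.single k c : Fin n → ℂ))) _ 0 :=
      hasDerivAt_pi.2 fun i => hasDerivAt_luPoint y k c i
    have h6 : HasFDerivAt (fun w => (f : CP n → ℝ) (affineChart (Fin.last n) w))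
        (fderiv ℝ (fun w => (f : CP n → ℝ) (affineChart (Fin.last n) w)) (luPoint y))
        (luPoint (y + (0 : ℝ) • (Pi.single k c : Fin n → ℂ))) := by
      simpa using ((f.2 (Fin.last n)).differentiable (by simp) (luPoint y)).hasFDerivAt
    have h7 := h6.comp_hasDerivAt (0 : ℝ) h5
    rw [h4.unique h7, hasFDerivAt_comp_affineChart, ← hx, fderiv_eq_wirtinger,
      Fin.sum_univ_castSucc]
    have hl : ∀ (u : Fin n → ℂ), ((Fin.last n).insertNth (α := fun _ => ℂ) 0 u :
        Fin (n + 1) → ℂ) (Fin.last n) = 0 := fun u => by simp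
    have hc : ∀ (u : Fin n → ℂ) (i : Fin n), ((Fin.last n).insertNth (α := fun _ => ℂ) 0 u :
        Fin (n + 1) → ℂ) i.castSucc = u i := fun u i => by
      rw [← Fin.succAbove_last, Fin.insertNth_apply_succAbove]
    simp only [hl, hc, mul_zero, Complex.zero_re, add_zero]
    congr 1
    have e : ∀ i : Fin n, (wirtinger (lift (f : CP n → ℝ)) x i.castSucc *
        (if i < k then luPoint y i * ((conj (y k) * c).re / (1 + Complex.normSq (y k)) : ℝ)
        else if i = k then c * (Real.sqrt (∏ j with i < j, (1 + Complex.normSq (y j))) : ℝ)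
        else 0)).re =
        (if i < k then (luPoint y i * wirtinger (lift (f : CP n → ℝ)) x i.castSucc).re *
          ((conj (y k) * c).re / (1 + Complex.normSq (y k))) else 0) +
        (if i = k then Real.sqrt (∏ j with k < j, (1 + Complex.normSq (y j))) *
          (wirtinger (lift (f : CP n → ℝ)) x k.castSucc * c).re else 0) := fun i => by
      by_cases h1 : i < k
      · rw [if_pos h1, if_pos h1, if_neg h1.ne, add_zero, ← mul_assoc, Complex.re_mul_ofReal,
          mul_comm (wirtinger _ _ _)]
      · rw [if_neg h1, if_neg h1, zero_add]
        by_cases h2 : i = k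
        · subst h2
          rw [if_pos rfl, if_pos rfl, ← mul_assoc, Complex.re_mul_ofReal, mul_comm]
        · simp [h2]
    rw [Finset.sum_congr rfl fun i _ => e i, Finset.sum_add_distrib, ← Finset.sum_filter,
      ← Finset.sum_mul]
    simp
  rw [wirtinger, hd, hd]
  generalize (∑ i with i < k, (luPoint y i * wirtinger (lift (f : CP n → ℝ)) x i.castSucc).re) = A
  generalize wirtinger (lift (f : CP n → ℝ)) x k.castSucc = F
  generalize Real.sqrt (∏ j with k < j, (1 + Complex.normSq (y j))) = E
  generalize 1 + Complex.normSq (y k) = q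
  apply Complex.ext
  · simp [Complex.div_re, Complex.div_im]
    ring
  · simp [Complex.div_re, Complex.div_im]
    ring

theorem sum_mul_sum_ordered {n : ℕ} (u v : Fin n → ℝ) :
    (∑ i, u i) * ∑ i, v i =
      ∑ k, (v k * (∑ i with i < k, u i) + u k * v k + u k * ∑ i with i < k, v i) := by
  have h : ∀ (u v : Fin n → ℝ), ∑ k, u k * ∑ i with i < k, v i =
      ∑ k, ∑ i, if i < k then u k * v i else 0 := fun u v => by
    refine Finset.sum_congr rfl fun k _ => ?_
    rw [Finset.mul_sum, Finset.sum_filter]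
  rw [Finset.sum_add_distrib, Finset.sum_add_distrib, h v u, h u v, Finset.sum_mul_sum,
    Finset.sum_comm (f := fun k i => if i < k then v k * u i else 0)]
  have h2 : ∑ k, u k * v k = ∑ k, ∑ i, if i = k then u k * v i else 0 := by simp
  rw [h2, ← Finset.sum_add_distrib, ← Finset.sum_add_distrib]
  refine Finset.sum_congr rfl fun k _ => ?_
  rw [← Finset.sum_add_distrib, ← Finset.sum_add_distrib]
  refine Finset.sum_congr rfl fun i _ => ?_
  rcases lt_trichotomy i k with h | h | h
  · simp [h, h.ne, h.not_gt]
  · simp [h]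
  · simp [h, h.ne', h.not_gt, mul_comm]

theorem im_lu_aux (y F G : ℂ) (E A B : ℝ) :
    (1 + Complex.normSq y) * ((E * F + conj y / (1 + Complex.normSq y : ℝ) * A) *
      conj (E * G + conj y / (1 + Complex.normSq y : ℝ) * B)).im =
    (1 + Complex.normSq y) * E ^ 2 * (F * conj G).im + (y * E * F).im * B -
      (y * E * G).im * A := by
  have hq : 1 + Complex.normSq y ≠ 0 := by have := Complex.normSq_nonneg y; positivity
  generalize hqd : 1 + Complex.normSq y = q at *
  have h : ∀ (H : ℂ) (D : ℝ), E * H + conj y / (q : ℂ) * D =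
      E * H + ((D / q : ℝ) : ℂ) * conj y := fun H D => by
    push_cast
    ring
  rw [h, h]
  obtain ⟨A', rfl⟩ : ∃ A', A = A' * q := ⟨A / q, by field_simp⟩
  obtain ⟨B', rfl⟩ : ∃ B', B = B' * q := ⟨B / q, by field_simp⟩
  rw [mul_div_cancel_right₀ _ hq, mul_div_cancel_right₀ _ hq]
  simp
  ring

/-- In Lu's coordinates, `π₀ = i ∑_k (1 + |y_k|²) ∂_{y_k} ∧ ∂_{ȳ_k}`. -/
theorem bruhat_luChart {n : ℕ} (f g : C n) (y : Fin n → ℂ) :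
    ((bruhat n f g : CP n → ℝ) (luChart y) : ℂ) =
      I * ∑ k, (1 + Complex.normSq (y k) : ℝ) *
        (wirtinger (fun w => (f : CP n → ℝ) (luChart w)) y k *
            conj (wirtinger (fun w => (g : CP n → ℝ) (luChart w)) y k) -
          conj (wirtinger (fun w => (f : CP n → ℝ) (luChart w)) y k) *
            wirtinger (fun w => (g : CP n → ℝ) (luChart w)) y k) := by
  rw [luChart, affineChart, bruhat, descendBivector_mk]
  simp only [wirtinger_luChart]
  have hF := sum_wirtinger_lift f (affineVec_ne_zero (Fin.last n) (luPoint y))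
  have hG := sum_wirtinger_lift g (affineVec_ne_zero (Fin.last n) (luPoint y))
  set x := affineVec (Fin.last n) (luPoint y) with hx
  have hxl : x (Fin.last n) = 1 := affineVec_same _ _
  have hxc : ∀ i : Fin n, x i.castSucc = luPoint y i := fun i => by
    rw [hx, ← Fin.succAbove_last, affineVec_succAbove]
  set F := wirtinger (lift (f : CP n → ℝ)) x with hFdef
  set G := wirtinger (lift (g : CP n → ℝ)) x with hGdef
  rw [Fin.sum_univ_castSucc] at hF hG
  simp only [hxl, hxc, one_mul] at hF hG
  set a : Fin n → ℂ := fun i => luPoint y i * F i.castSucc with ha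
  set b : Fin n → ℂ := fun i => luPoint y i * G i.castSucc with hb
  have hF' : F (Fin.last n) = -∑ i, a i := eq_neg_of_add_eq_zero_right hF
  have hG' : G (Fin.last n) = -∑ i, b i := eq_neg_of_add_eq_zero_right hG
  set E : Fin n → ℝ := fun k => Real.sqrt (∏ j with k < j, (1 + Complex.normSq (y j))) with hE
  have hz : ∀ k, luPoint y k = y k * E k := fun k => rfl
  have hEsq : ∀ k, 1 + ∑ j with k < j, Complex.normSq (luPoint y j) = E k ^ 2 := fun k => by
    rw [luFactor_eq, hE, Real.sq_sqrt (luFactor_pos y k).le]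
  have hgt : ∀ {M : Type} [AddCommMonoid M] (k : Fin n) (h : Fin (n + 1) → M),
      ∑ l with k.castSucc < l, h l = (∑ i with k < i, h i.castSucc) + h (Fin.last n) := by
    intro M _ k h
    rw [Finset.sum_filter, Finset.sum_filter, Fin.sum_univ_castSucc]
    simp [Fin.castSucc_lt_last]
  have hlt : ∀ {M : Type} [AddCommMonoid M] (k : Fin n) (h : Fin (n + 1) → M),
      ∑ l with l < k.castSucc, h l = ∑ i with i < k, h i.castSucc := by
    intro M _ k h
    rw [Finset.sum_filter, Finset.sum_filter, Fin.sum_univ_castSucc]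
    simp [(Fin.castSucc_lt_last k).not_gt]
  have htot : ∀ k : Fin n, (∑ i with k < i, a i) + F (Fin.last n) =
      -((∑ i with i < k, a i) + a k) := fun k => by
    have : ∑ i, a i = (∑ i with i < k, a i) + a k + ∑ i with k < i, a i := by
      have h1 : ∀ i, a i = ((if i < k then a i else 0) + (if i = k then a i else 0)) +
          (if k < i then a i else 0) := fun i => by
        rcases lt_trichotomy i k with h | h | h
        · simp [h, h.ne, h.not_gt]
        · simp [h]
        · simp [h, h.ne', h.not_gt]
      rw [Finset.sum_filter, Finset.sum_filter]
      conv_lhs => rw [Finset.sum_congr rfl fun i _ => h1 i, Finset.sum_add_distrib,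
        Finset.sum_add_distrib]
      simp
    rw [hF', this]
    ring
  have hY : ∀ k : Fin n, 2 * (G k.castSucc * bruhatSharp x F k.castSucc).re =
      2 * ((b k).re * (∑ i with i < k, (a i).im) + (b k).im * ∑ i with i < k, (a i).re) +
        2 * ((a k).im * (b k).re) -
        2 * ((1 + Complex.normSq (y k)) * E k ^ 2 * (F k.castSucc * conj (G k.castSucc)).im) := by
    intro k
    have h1 : ∑ l with k.castSucc < l, x l * x k.castSucc * F l =
        -(luPoint y k * ((∑ i with i < k, a i) + a k)) := by
      rw [hgt, hxl, hxc, neg_mul_eq_mul_neg, ← htot, mul_add, Finset.mul_sum]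
      congr 1
      · exact Finset.sum_congr rfl fun i _ => by rw [hxc, ha]; ring
      · ring
    have h2 : ∑ l with l < k.castSucc, x l * x k.castSucc * F l =
        luPoint y k * ∑ i with i < k, a i := by
      rw [hlt, hxc, Finset.mul_sum]
      exact Finset.sum_congr rfl fun i _ => by rw [hxc, ha]; ring
    have h3 : ∑ l with k.castSucc < l, Complex.normSq (x l) = E k * E k := by
      rw [hgt, hxl, ← sq, ← hEsq, add_comm]
      simp [hxc]
    rw [bruhatSharp, h1, h2, h3, hxc]
    have h4 : (∑ i with i < k, (a i).im) = (∑ i with i < k, a i).im := (Complex.im_sum _ _).symm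
    have h5 : (∑ i with i < k, (a i).re) = (∑ i with i < k, a i).re := (Complex.re_sum _ _).symm
    rw [h4, h5]
    have h6 : a k = y k * E k * F k.castSucc := by simp only [ha]; rw [hz]
    have h7 : b k = y k * E k * G k.castSucc := by simp only [hb]; rw [hz]
    rw [h6, h7, hz]
    generalize (∑ i with i < k, a i) = c
    simp [Complex.normSq_apply]
    ring
  have hlast : 2 * (G (Fin.last n) * bruhatSharp x F (Fin.last n)).re =
      -2 * ((∑ i, (a i).im) * ∑ i, (b i).re) := by
    have h1 : ∑ l with Fin.last n < l, x l * x (Fin.last n) * F l = 0 := by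
      rw [Finset.sum_filter]
      exact Finset.sum_eq_zero fun l _ => by simp [(Fin.le_last l).not_gt]
    have h2 : ∑ l with l < Fin.last n, x l * x (Fin.last n) * F l = ∑ i, a i := by
      rw [Finset.sum_filter, Fin.sum_univ_castSucc]
      simp [Fin.castSucc_lt_last, hxc, hxl, ha]
    have h3 : ∑ l with Fin.last n < l, Complex.normSq (x l) = 0 := by
      rw [Finset.sum_filter]
      exact Finset.sum_eq_zero fun l _ => by simp [(Fin.le_last l).not_gt]
    rw [bruhatSharp, h1, h2, h3, hxl, hF', hG', ← Complex.im_sum, ← Complex.re_sum]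
    generalize (∑ i, a i) = s
    generalize (∑ i, b i) = r
    simp
    ring
  have hR : ∀ k : Fin n, I * (((1 + Complex.normSq (y k) : ℝ) : ℂ) *
      ((E k * F k.castSucc + conj (y k) / (1 + Complex.normSq (y k) : ℝ) *
          ((∑ i with i < k, (a i).re : ℝ) : ℂ)) *
        conj (E k * G k.castSucc + conj (y k) / (1 + Complex.normSq (y k) : ℝ) *
          ((∑ i with i < k, (b i).re : ℝ) : ℂ)) -
        conj (E k * F k.castSucc + conj (y k) / (1 + Complex.normSq (y k) : ℝ) *
          ((∑ i with i < k, (a i).re : ℝ) : ℂ)) *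
        (E k * G k.castSucc + conj (y k) / (1 + Complex.normSq (y k) : ℝ) *
          ((∑ i with i < k, (b i).re : ℝ) : ℂ)))) =
      ((-2 * ((1 + Complex.normSq (y k)) * E k ^ 2 * (F k.castSucc * conj (G k.castSucc)).im +
        (a k).im * (∑ i with i < k, (b i).re) - (b k).im * ∑ i with i < k, (a i).re) : ℝ) : ℂ) := by
    intro k
    have h6 : a k = y k * E k * F k.castSucc := by simp only [ha]; rw [hz]
    have h7 : b k = y k * E k * G k.castSucc := by simp only [hb]; rw [hz]
    rw [h6, h7, ← im_lu_aux]
    generalize (E k * F k.castSucc + conj (y k) / (1 + Complex.normSq (y k) : ℝ) *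
          ((∑ i with i < k, (a i).re : ℝ) : ℂ)) = u
    generalize (E k * G k.castSucc + conj (y k) / (1 + Complex.normSq (y k) : ℝ) *
          ((∑ i with i < k, (b i).re : ℝ) : ℂ)) = v
    generalize 1 + Complex.normSq (y k) = q
    apply Complex.ext
    · simp
      ring
    · simp
  conv_rhs => rw [Finset.mul_sum]
  refine Eq.trans ?_ (Finset.sum_congr rfl fun k _ => (hR k).symm)
  rw [← Complex.ofReal_sum, Complex.ofReal_inj, Fin.sum_univ_castSucc, mul_add, hlast,
    Finset.mul_sum, Finset.sum_congr rfl fun k _ => hY k,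
    sum_mul_sum_ordered (fun i => (a i).im) fun i => (b i).re, Finset.mul_sum,
    ← Finset.sum_add_distrib]
  exact Finset.sum_congr rfl fun k _ => by ring

theorem fubiniStudy_skew {n : ℕ} (f g : C n) : fubiniStudy n f g = -fubiniStudy n g f := by
  ext p
  induction p using Projectivization.ind with
  | h x hx =>
    change (fubiniStudy n f g : CP n → ℝ) _ = -(fubiniStudy n g f : CP n → ℝ) _
    rw [fubiniStudy, descendBivector_mk, descendBivector_mk, ← mul_neg, ← Finset.sum_neg_distrib]
    congr 1
    refine Finset.sum_congr rfl fun k _ => ?_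
    unfold fubiniStudySharp
    generalize (∑ l, Complex.normSq (x l)) = N
    simp
    ring

theorem bruhat_skew {n : ℕ} (f g : C n) : bruhat n f g = -bruhat n g f := by
  ext p
  induction p using Projectivization.ind with
  | h x hx =>
    change (bruhat n f g : CP n → ℝ) _ = -(bruhat n g f : CP n → ℝ) _
    rw [bruhat, descendBivector_mk, descendBivector_mk, ← mul_neg]
    congr 1
    generalize wirtinger (lift (f : CP n → ℝ)) x = α
    generalize wirtinger (lift (g : CP n → ℝ)) x = β
    have h1 : ∀ α β : Fin (n + 1) → ℂ, ∑ k, (β k * bruhatSharp x α k).re =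
        (I / 2 * ((∑ k, ∑ l, if k < l then x l * x k * α l * β k else 0) -
          ∑ k, ∑ l, if l < k then x l * x k * α l * β k else 0)).re +
        ∑ k, (Complex.normSq (x k) / 2 + ∑ l with k < l, Complex.normSq (x l)) *
          (conj (α k) * β k).im := fun α β => by
      rw [← Finset.sum_sub_distrib, Finset.mul_sum, Complex.re_sum, ← Finset.sum_add_distrib]
      refine Finset.sum_congr rfl fun k _ => ?_
      have e1 : ∑ l, (if k < l then x l * x k * α l * β k else 0) =
          (∑ l with k < l, x l * x k * α l) * β k := by
        rw [Finset.sum_filter, Finset.sum_mul]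
        exact Finset.sum_congr rfl fun l _ => by split_ifs <;> simp
      have e2 : ∑ l, (if l < k then x l * x k * α l * β k else 0) =
          (∑ l with l < k, x l * x k * α l) * β k := by
        rw [Finset.sum_filter, Finset.sum_mul]
        exact Finset.sum_congr rfl fun l _ => by split_ifs <;> simp
      rw [e1, e2, bruhatSharp]
      generalize (∑ l with k < l, x l * x k * α l) = A
      generalize (∑ l with l < k, x l * x k * α l) = B
      generalize Complex.normSq (x k) / 2 + ∑ l with k < l, Complex.normSq (x l) = W
      simp
      ring
    rw [h1 α β, h1 β α]
    have h2 : ∀ α β : Fin (n + 1) → ℂ,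
        (∑ k, ∑ l, if l < k then x l * x k * α l * β k else 0) =
        ∑ k, ∑ l, if k < l then x l * x k * β l * α k else 0 := fun α β => by
      rw [Finset.sum_comm]
      refine Finset.sum_congr rfl fun k _ => Finset.sum_congr rfl fun l _ => ?_
      split_ifs <;> ring
    rw [h2 α β, h2 β α]
    have h3 : ∀ k, (conj (α k) * β k).im = -(conj (β k) * α k).im := fun k => by
      simp
      ring
    simp only [h3, mul_neg, Finset.sum_neg_distrib]
    rw [← neg_sub (∑ k, ∑ l, if k < l then x l * x k * β l * α k else 0), mul_neg, Complex.neg_re]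
    ring

/-- The bivector fields of the pencil are skew-symmetric. -/
theorem pencil_skew {n : ℕ} (t : ℝ) (f g : C n) : pencil n t f g = -pencil n t g f := by
  simp only [pencil, LinearMap.add_apply, LinearMap.smul_apply, Derivation.add_apply,
    Derivation.smul_apply]
  rw [bruhat_skew f g, fubiniStudy_skew f g, smul_neg, neg_add]

/-- The top exterior power `Ωⁿ / n!` of a two-form `Ω` on `ℂⁿ = ℝ²ⁿ`, evaluated on a family of
`2n` vectors (ordered lexicographically by `Fin n × Fin 2`). -/
def topPower {n : ℕ} (Ω : (Fin n → ℂ) → (Fin n → ℂ) → ℝ) (v : Fin n × Fin 2 → Fin n → ℂ) : ℝ :=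
  (1 / ((n.factorial : ℝ) * 2 ^ n)) * ∑ s : Equiv.Perm (Fin n × Fin 2),
    ((Equiv.Perm.sign s : ℤ) : ℝ) * ∏ i, Ω (v (s (i, 0))) (v (s (i, 1)))

/-- The coordinate frame `∂/∂Re z_1, ∂/∂Im z_1, …, ∂/∂Re z_n, ∂/∂Im z_n`. -/
def realFrame {n : ℕ} (a : Fin n × Fin 2) : Fin n → ℂ :=
  Pi.single a.1 (if a.2 = 0 then 1 else I)

/-- A volume form, given in each affine chart by its coefficient with respect to the coordinate
volume form `dRe z_1 ∧ dIm z_1 ∧ … ∧ dRe z_n ∧ dIm z_n`. -/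
abbrev VolumeForm (n : ℕ) : Type := Fin (n + 1) → (Fin n → ℂ) → ℝ

/-- The Fubini-Study volume form `ω_λⁿ / n!`. -/
def fubiniStudyVolume (n : ℕ) : VolumeForm n := fun _ z => topPower (fubiniStudyForm z) realFrame

/-- `d` is the divergence of the vector field `X` with respect to the volume form `V`, that is
`L_X V = d V`: in each chart `∑_a ∂_a (V ξ^a) = d V`, where `ξ` represents `X` in that chart. -/
def IsDivergence {n : ℕ} (V : VolumeForm n) (X : VectorField n) (d : C n) : Prop :=
  ∀ j, ∃ ξ, Represents X j ξ ∧ ∀ z,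
    LinearMap.trace ℝ (Fin n → ℂ) (fderiv ℝ (fun w => V j w • ξ w) z : (Fin n → ℂ) →ₗ[ℝ] _) =
      V j z * (d : CP n → ℝ) (affineChart j z)

/-- `χ` is the modular vector field `div_V π`: for each `f`, the function `χ f` is the divergence
of the Hamiltonian vector field `{·, f} = -{f, ·}`. -/
def IsModularVectorField {n : ℕ} (V : VolumeForm n) (π : BivectorField n) (χ : VectorField n) :
    Prop :=
  ∀ f, IsDivergence V (-π f) (χ f)

/-- The Poisson vector fields, that is the kernel of the Lichnerowicz-Poisson differential
`X ↦ [π, X]`. -/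
def poissonVectorFields {n : ℕ} (π : BivectorField n) : Submodule ℝ (VectorField n) where
  carrier := {X | ∀ f g, X (π f g) = π (X f) g + π f (X g)}
  add_mem' {X Y} hX hY f g := by
    simp only [Derivation.add_apply, map_add, hX f g, hY f g]
    abel
  zero_mem' f g := by simp
  smul_mem' r X hX f g := by
    simp only [Derivation.smul_apply, map_smul, Derivation.map_smul, hX f g, smul_add]

/-- The Hamiltonian vector fields. -/
def hamiltonianVectorFields {n : ℕ} (π : BivectorField n) : Submodule ℝ (VectorField n) :=
  LinearMap.range π

/-- The first Lichnerowicz-Poisson cohomology: Poisson modulo Hamiltonian vector fields. -/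
abbrev LichnerowiczPoissonH1 {n : ℕ} (π : BivectorField n) : Type :=
  poissonVectorFields π ⧸ (hamiltonianVectorFields π).submoduleOf (poissonVectorFields π)

/-- The class of a Poisson vector field. -/
def lpClass {n : ℕ} {π : BivectorField n} {X : VectorField n} (hX : X ∈ poissonVectorFields π) :
    LichnerowiczPoissonH1 π :=
  Submodule.Quotient.mk ⟨X, hX⟩

end

end CPn

/-!
The bivector field `π_t` is lifted to `ℂⁿ⁺¹ ∖ {0}`, where everything is explicit. Let `s_{kl}` be the
sign of `l - k` and let `F_k = ∂f/∂X_k`. The lift of `{f, ·}` has the components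
`Y_k = (i/2) (∑_l s_{kl} X_l F_l) X_k - i W_k F̄_k` with
`W_k = ∑_l ((1 + s_{kl})/2 - t) |X_l|²` (`pencilSharp`, `pencil_mk`).

*The modular vector field.* The Fubini-Study volume has density proportional to
`(1 + |z|²)^{-(n+1)}` (`fubiniStudyVolume_eq`): its value is that of the standard form, multiplied by
the determinant of a linear map pulling the standard form back to `ω_λ`. Hence the divergence of the
vector field induced by a homogeneous field `v` is
`2 Re ∑ ∂_k v_k - 2 (n+1) Re ⟨v, X⟩ / |X|²` (`isDivergence_fubiniStudyVolume`). For `v = -Y` the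
second term vanishes by Euler's relation `∑ X_k F_k = 0`. In the first one, the second derivatives
of `f` cancel because `s` is antisymmetric and `∂_k ∂̄_k f` is real, and what remains is
`2 Re ∑_l i (n/2 - l) X_l F_l`, for `l = 0, …, n`. This is the derivative of `f` along the fundamental
vector field of `i diag (n/2 - l)`, the half-sum of the positive roots. Uniqueness holds because the
components of the moment map of the unitary group separate tangent vectors
(`exists_eq_smul_of_fderiv_lift_eq_zero`).

*The Poisson property.* The coefficients of the lifted bivector field are invariant under the
diagonal torus.

*The modular class.* If the modular vector field were the Hamiltonian vector field of `f`, then on the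
projective line `X_1 = … = X_{n-1} = 0` the number `a = X_{n+1} ∂f/∂X_{n+1}` would satisfy
`ā |X|² (|X_{n+1}|² - t |X|²) = |X_n|² |X_{n+1}|²` (`hamiltonian_on_last_line`). For `0 < t < 1` this
fails where `|X_{n+1}|² = t |X|²`. For `t = 0` it gives `a → 1` as `X_{n+1} → 0`, and for `t = 1` it
gives `a → -1` as `X_n → 0`, whereas `a` is continuous and vanishes at both limit points.
-/

namespace CPn

noncomputable section

/-! ### Tangent vectors are separated by functions -/

theorem sum_normSq_pos {m : ℕ} {x : Fin m → ℂ} (hx : x ≠ 0) :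
    0 < ∑ l, Complex.normSq (x l) := by
  obtain ⟨j, hj⟩ := Function.ne_iff.1 hx
  exact Finset.sum_pos' (fun l _ => Complex.normSq_nonneg _)
    ⟨j, Finset.mem_univ _, Complex.normSq_pos.2 hj⟩

/-- The function `[X] ↦ Re (c X_k X̄_l) / |X|²`, a component of the moment map of the unitary
group. -/
def momentComponent {n : ℕ} (c : ℂ) (k l : Fin (n + 1)) : C n :=
  ⟨fun p => (c * p.rep k * conj (p.rep l)).re / ∑ i, Complex.normSq (p.rep i), fun j => by
    have e : (fun z => (c * (affineChart j z).rep k * conj ((affineChart j z).rep l)).re /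
        ∑ i, Complex.normSq ((affineChart j z).rep i)) =
        fun z => (c * affineVec j z k * conj (affineVec j z l)).re /
          ∑ i, Complex.normSq (affineVec j z i) := by
      ext z
      obtain ⟨a, ha⟩ := Projectivization.exists_smul_eq_mk_rep ℂ (affineVec j z)
        (affineVec_ne_zero j z)
      have h0 : Complex.normSq (a : ℂ) ≠ 0 := Complex.normSq_eq_zero.not.2 a.ne_zero
      have h1 : c * ((a : ℂ) * affineVec j z k) * conj ((a : ℂ) * affineVec j z l) =
          (Complex.normSq (a : ℂ) : ℝ) * (c * affineVec j z k * conj (affineVec j z l)) := by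
        rw [← Complex.mul_conj, map_mul]
        ring
      rw [affineChart, ← ha]
      simp only [Units.smul_def, Pi.smul_apply, smul_eq_mul, h1, Complex.re_ofReal_mul,
        Complex.normSq_mul, ← Finset.mul_sum]
      exact mul_div_mul_left _ _ h0
    have h := contDiff_pi.1 (contDiff_affineVec j)
    rw [e]
    refine ContDiff.div (Complex.reCLM.contDiff.comp ((contDiff_const.mul (h k)).mul
      (Complex.conjCLE.contDiff.comp (h l)))) (ContDiff.sum fun i _ => contDiff_normSq' (h i))
      fun z => (sum_normSq_pos (affineVec_ne_zero j z)).ne'⟩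

theorem lift_momentComponent {n : ℕ} (c : ℂ) (k l : Fin (n + 1)) {x : Fin (n + 1) → ℂ}
    (hx : x ≠ 0) : lift (momentComponent c k l : CP n → ℝ) x * ∑ i, Complex.normSq (x i) =
      (c * x k * conj (x l)).re := by
  obtain ⟨a, ha⟩ := Projectivization.exists_smul_eq_mk_rep ℂ x hx
  have h0 : Complex.normSq (a : ℂ) ≠ 0 := Complex.normSq_eq_zero.not.2 a.ne_zero
  have h1 : c * ((a : ℂ) * x k) * conj ((a : ℂ) * x l) =
      (Complex.normSq (a : ℂ) : ℝ) * (c * x k * conj (x l)) := by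
    rw [← Complex.mul_conj, map_mul]
    ring
  rw [lift_of_ne _ hx]
  change (c * (Projectivization.mk ℂ x hx).rep k * conj ((Projectivization.mk ℂ x hx).rep l)).re /
    (∑ i, Complex.normSq ((Projectivization.mk ℂ x hx).rep i)) * _ = _
  rw [← ha]
  simp only [Units.smul_def, Pi.smul_apply, smul_eq_mul, h1, Complex.re_ofReal_mul,
        Complex.normSq_mul, ← Finset.mul_sum]
  rw [mul_div_mul_left _ _ h0, div_mul_cancel₀ _ (sum_normSq_pos hx).ne']

theorem hasDerivAt_line {E : Type*} [NormedAddCommGroup E] [NormedSpace ℝ E] (x v : E) :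
    HasDerivAt (fun s : ℝ => x + s • v) v 0 := by
  simpa using ((hasDerivAt_id (0 : ℝ)).smul_const v).const_add x

theorem hasDerivAt_comp_line {E F : Type*} [NormedAddCommGroup E] [NormedSpace ℝ E]
    [NormedAddCommGroup F] [NormedSpace ℝ F] {u : E → F} {x : E} (hu : DifferentiableAt ℝ u x)
    (v : E) : HasDerivAt (fun s : ℝ => u (x + s • v)) (fderiv ℝ u x v) 0 := by
  have : HasFDerivAt u (fderiv ℝ u x) (x + (0 : ℝ) • v) := by simpa using hu.hasFDerivAt
  exact this.comp_hasDerivAt (0 : ℝ) (hasDerivAt_line x v)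

theorem eventually_line_ne_zero {m : ℕ} {x : Fin m → ℂ} (hx : x ≠ 0) (v : Fin m → ℂ) :
    ∀ᶠ s : ℝ in nhds 0, x + s • v ≠ 0 := by
  have : ContinuousAt (fun s : ℝ => x + s • v) 0 := (hasDerivAt_line x v).continuousAt
  exact this.eventually_ne (by simpa using hx)

theorem hasDerivAt_coord_line {m : ℕ} (x v : Fin m → ℂ) (k : Fin m) :
    HasDerivAt (fun s : ℝ => (x + s • v) k) (v k) 0 :=
  hasDerivAt_pi.1 (hasDerivAt_line x v) k

theorem hasDerivAt_conj {u : ℝ → ℂ} {u' : ℂ} {s : ℝ} (h : HasDerivAt u u' s) :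
    HasDerivAt (fun s => conj (u s)) (conj u') s :=
  Complex.conjCLE.hasFDerivAt.comp_hasDerivAt s h

theorem hasDerivAt_re {u : ℝ → ℂ} {u' : ℂ} {s : ℝ} (h : HasDerivAt u u' s) :
    HasDerivAt (fun s => (u s).re) u'.re s :=
  Complex.reCLM.hasFDerivAt.comp_hasDerivAt s h

theorem hasDerivAt_normSq {u : ℝ → ℂ} {u' : ℂ} {s : ℝ} (h : HasDerivAt u u' s) :
    HasDerivAt (fun s => Complex.normSq (u s)) (2 * (u' * conj (u s)).re) s := by
  have h1 := hasDerivAt_re (h.mul (hasDerivAt_conj h))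
  refine (h1.congr_deriv ?_).congr_of_eventuallyEq (Filter.Eventually.of_forall fun s => ?_)
  · simp
    ring
  · simp [Complex.mul_conj]

/-- The vectors annihilated by the differentials of all smooth functions on projective space are
those tangent to the line through the base point. -/
theorem exists_eq_smul_of_fderiv_lift_eq_zero {n : ℕ} {x v : Fin (n + 1) → ℂ} (hx : x ≠ 0)
    (h : ∀ g : C n, fderiv ℝ (lift (g : CP n → ℝ)) x v = 0) : ∃ μ : ℂ, v = μ • x := by
  set N := ∑ i, Complex.normSq (x i) with hN
  have hN0 : N ≠ 0 := (sum_normSq_pos hx).ne'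
  set d := ∑ i, 2 * (v i * conj (x i)).re with hd
  have hne := eventually_line_ne_zero hx v
  -- differentiate `|x|² · g = Re (c x_k x̄_l)` along `v`, using `dg(v) = 0`
  have key : ∀ c k l, (c * (v k * conj (x l) + x k * conj (v l))).re =
      (c * x k * conj (x l)).re / N * d := fun c k l => by
    have h1 := hasDerivAt_comp_line (differentiableAt_lift (momentComponent c k l) hx) v
    rw [h] at h1
    have h2 : HasDerivAt (fun s : ℝ => ∑ i, Complex.normSq ((x + s • v) i)) d 0 := by
      have := HasDerivAt.fun_sum (u := Finset.univ)
        fun i _ => hasDerivAt_normSq (hasDerivAt_coord_line x v i)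
      simpa [hd] using this
    have h3 := (hasDerivAt_re (((hasDerivAt_coord_line x v k).const_mul c).mul
      (hasDerivAt_conj (hasDerivAt_coord_line x v l))))
    have h4 := (h1.mul h2).congr_of_eventuallyEq (f₁ := fun s : ℝ =>
      (c * (x + s • v) k * conj ((x + s • v) l)).re) (by
        filter_upwards [hne] with s hs
        exact (lift_momentComponent c k l hs).symm)
    have h5 := h3.unique h4
    have h6 := lift_momentComponent c k l hx
    rw [← hN, ← eq_div_iff hN0] at h6
    simp only [zero_smul, add_zero, zero_mul, zero_add, h6] at h5
    rw [← h5]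
    congr 1
    ring
  obtain ⟨l, hl⟩ := Function.ne_iff.1 hx
  have key2 : ∀ k, v k * conj (x l) + x k * conj (v l) = ((d / N : ℝ) : ℂ) * (x k * conj (x l)) :=
    fun k => by
    have h1 := key 1 k l
    have h2 := key (-I) k l
    apply Complex.ext
    · rw [Complex.re_ofReal_mul]
      rw [one_mul, one_mul] at h1
      rw [h1]
      ring
    · rw [Complex.im_ofReal_mul]
      rw [mul_assoc (-I)] at h2
      generalize x k * conj (x l) = a at *
      generalize v k * conj (x l) + x k * conj (v l) = b at *
      have h3 : b.im = a.im / N * d := by simpa using h2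
      rw [h3]
      ring
  have hl' : conj (x l) ≠ 0 := (map_ne_zero _).2 hl
  refine ⟨(d / N : ℝ) - conj (v l) / conj (x l), funext fun k => ?_⟩
  have := key2 k
  simp only [Pi.smul_apply, smul_eq_mul]
  field_simp
  linear_combination this

/-- A vector field has at most one representative in each affine chart. -/
theorem Represents.unique {n : ℕ} {X : VectorField n} {j : Fin (n + 1)}
    {ξ η : (Fin n → ℂ) → Fin n → ℂ} (hξ : Represents X j ξ) (hη : Represents X j η) : ξ = η := by
  ext1 z
  obtain ⟨μ, hμ⟩ := exists_eq_smul_of_fderiv_lift_eq_zero (affineVec_ne_zero j z)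
    (v := j.insertNth (α := fun _ => ℂ) 0 (ξ z - η z)) fun g => by
      rw [← hasFDerivAt_comp_affineChart, map_sub, ← hξ.2, ← hη.2, sub_self]
  have h0 : μ = 0 := by simpa using (congrFun hμ j).symm
  ext a
  have := congrFun hμ (j.succAbove a)
  simpa [h0, sub_eq_zero] using this

theorem exists_affineChart_eq {n : ℕ} (p : CP n) : ∃ j z, affineChart j z = p := by
  induction p using Projectivization.ind with
  | h x hx =>
    obtain ⟨j, hj⟩ := Function.ne_iff.1 hx
    refine ⟨j, fun a => x (j.succAbove a) * (x j)⁻¹, ?_⟩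
    rw [affineChart, Projectivization.mk_eq_mk_iff']
    refine ⟨(x j)⁻¹, ?_⟩
    ext k
    rcases Fin.eq_self_or_eq_succAbove j k with rfl | ⟨a, rfl⟩
    · simpa using inv_mul_cancel₀ hj
    · simp [mul_comm]

theorem isModularVectorField_unique {n : ℕ} {V : VolumeForm n} (hV : ∀ j z, V j z ≠ 0)
    {π : BivectorField n} {χ χ' : VectorField n} (h : IsModularVectorField V π χ)
    (h' : IsModularVectorField V π χ') : χ = χ' := by
  ext f p
  obtain ⟨j, z, rfl⟩ := exists_affineChart_eq p
  obtain ⟨ξ, hξ, h1⟩ := h f j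
  obtain ⟨η, hη, h2⟩ := h' f j
  rw [hξ.unique hη] at h1
  exact mul_left_cancel₀ (hV j z) ((h1 z).symm.trans (h2 z))

/-! ### The Cartan subalgebra -/

theorem fundamental_sum {n : ℕ} {ι : Type*} (s : Finset ι)
    (H : ι → Matrix (Fin (n + 1)) (Fin (n + 1)) ℂ) :
    ∑ k ∈ s, fundamental (H k) = fundamental (∑ k ∈ s, H k) := by
  have hadd : ∀ A B : Matrix (Fin (n + 1)) (Fin (n + 1)) ℂ,
      fundamental A + fundamental B = fundamental (A + B) := fun A B => by
    ext f p
    rw [Derivation.add_apply, C.coe_add, Pi.add_apply]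
    simp only [fundamental, descend_apply, Matrix.vecMul_add, map_add]
  have hzero : fundamental (0 : Matrix (Fin (n + 1)) (Fin (n + 1)) ℂ) = 0 := by
    ext f p
    simp [fundamental, descend_apply]
  let φ : Matrix (Fin (n + 1)) (Fin (n + 1)) ℂ →+ VectorField n :=
    ⟨⟨fundamental, hzero⟩, fun A B => (hadd A B).symm⟩
  exact (map_sum φ H s).symm

/-- `∑_{a<b} (ε_a - ε_b)` has coefficient `(n - l) - l` at `ε_l`. -/
theorem halfSumPositiveRoots_eq_diagonal (n : ℕ) :
    halfSumPositiveRoots n =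
      Matrix.diagonal fun l : Fin (n + 1) => I * ((n / 2 - (l : ℕ) : ℝ) : ℂ) := by
  have h : ∑ a : Fin (n + 1), ∑ b with a < b,
      (Matrix.single a a (1 : ℂ) - Matrix.single b b (1 : ℂ)) =
      ∑ a : Fin (n + 1), ((n : ℂ) - 2 * (a : ℕ)) • Matrix.single a a (1 : ℂ) := by
    simp only [Finset.sum_sub_distrib, Finset.sum_const, Finset.sum_filter]
    rw [Finset.sum_comm (f := fun a b : Fin (n + 1) =>
      if a < b then Matrix.single b b (1 : ℂ) else 0), ← Finset.sum_sub_distrib]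
    refine Finset.sum_congr rfl fun a _ => ?_
    rw [← Finset.sum_filter, Finset.sum_const]
    have h1 : ((Finset.univ.filter fun b => a < b).card : ℂ) = n - (a : ℕ) := by
      rw [Finset.filter_lt_eq_Ioi, Fin.card_Ioi, Nat.add_sub_cancel, Nat.cast_sub (by omega)]
    have h2 : ((Finset.univ.filter fun b => b < a).card : ℂ) = (a : ℕ) := by
      rw [Finset.filter_gt_eq_Iio, Fin.card_Iio]
    rw [← Nat.cast_smul_eq_nsmul ℂ, ← Nat.cast_smul_eq_nsmul ℂ, h1, h2, ← sub_smul]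
    congr 1
    ring
  rw [halfSumPositiveRoots, h]
  ext i j
  simp only [Matrix.smul_apply, Matrix.sum_apply, Matrix.single_apply, Matrix.diagonal_apply]
  by_cases hij : i = j
  · subst hij
    simp
    ring
  · have : ∀ c : Fin (n + 1), ¬(c = i ∧ c = j) := fun c hc => hij (hc.1.symm.trans hc.2)
    simp [this, hij]

theorem sum_cartan (n : ℕ) : ∑ k, cartan n k = halfSumPositiveRoots n := by
  rw [halfSumPositiveRoots_eq_diagonal]
  have hn : (n : ℂ) + 1 ≠ 0 := by exact_mod_cast n.succ_ne_zero
  ext i j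
  simp only [cartan, Matrix.sum_apply, Matrix.smul_apply, Matrix.diagonal_apply, smul_eq_mul]
  by_cases hij : i = j
  · subst hij
    simp only [if_true]
    -- the `l`-th entry is `i/(n+1)` times `(n+1) #{k | k ≥ l} - ∑ k`
    have h1 : ∀ k : Fin n, (if (i : ℕ) < k + 1 then (n : ℂ) + 1 - (k + 1) else -(k + 1)) =
        ((n : ℂ) + 1) * (if (i : ℕ) ≤ k then 1 else 0) - ((k : ℕ) + 1) := fun k => by
      split_ifs <;> first | omega | ring
    rw [← Finset.mul_sum, Finset.sum_congr rfl fun k _ => h1 k, Finset.sum_sub_distrib,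
      ← Finset.mul_sum]
    have h2 : ∑ k : Fin n, (if (i : ℕ) ≤ k then (1 : ℂ) else 0) = n - (i : ℕ) := by
      rw [Fin.sum_univ_eq_sum_range (fun k => if (i : ℕ) ≤ k then (1 : ℂ) else 0) n,
        ← Finset.sum_filter, Finset.sum_const, nsmul_one]
      have : (Finset.range n).filter (fun k => (i : ℕ) ≤ k) = Finset.Ico (i : ℕ) n := by
        ext k
        simp [and_comm]
      rw [this, Nat.card_Ico, Nat.cast_sub (by omega)]
    have h3 : ∑ k : Fin n, (((k : ℕ) : ℂ) + 1) = n * (n + 1) / 2 := by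
      rw [Fin.sum_univ_eq_sum_range (fun k => (k : ℂ) + 1) n]
      clear * -
      induction n with
      | zero => simp
      | succ m ih =>
        rw [Finset.sum_range_succ, ih]
        push_cast
        ring
    rw [h2, h3]
    push_cast
    field_simp
    ring
  · simp [hij]

/-! ### The pencil in homogeneous coordinates -/

/-- The sign of `l - k`. -/
def ordSign {m : ℕ} (k l : Fin m) : ℝ := if k < l then 1 else if l < k then -1 else 0

theorem ordSign_swap {m : ℕ} (k l : Fin m) : ordSign l k = -ordSign k l := by
  unfold ordSign
  rcases lt_trichotomy k l with h | h | h
  · simp [h, h.not_gt]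
  · simp [h]
  · simp [h, h.not_gt]

@[simp] theorem ordSign_self {m : ℕ} (k : Fin m) : ordSign k k = 0 := by simp [ordSign]

/-- The weight `∑_l ((1 + sign (l - k))/2 - t) |X_l|²`, that is,
`|X_k|²/2 + ∑_{l>k} |X_l|² - t |X|²`. -/
def pencilWeight {m : ℕ} (t : ℝ) (x : Fin m → ℂ) (k : Fin m) : ℝ :=
  ∑ l, ((1 + ordSign k l) / 2 - t) * Complex.normSq (x l)

/-- Contraction of a differential (in the first slot) with the lift of `π_t` to `ℂⁿ⁺¹ ∖ {0}`. -/
def pencilSharp {m : ℕ} (t : ℝ) (x α : Fin m → ℂ) (k : Fin m) : ℂ :=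
  I / 2 * (∑ l, ordSign k l * (x l * α l)) * x k - I * pencilWeight t x k * conj (α k)

theorem pencilSharp_eq {n : ℕ} (t : ℝ) (x α : Fin (n + 1) → ℂ) (k : Fin (n + 1)) :
    pencilSharp t x α k = bruhatSharp x α k + t * fubiniStudySharp x α k := by
  have h1 : (∑ l, (ordSign k l : ℂ) * (x l * α l)) * x k =
      (∑ l with k < l, x l * x k * α l) - ∑ l with l < k, x l * x k * α l := by
    rw [Finset.sum_mul, Finset.sum_filter, Finset.sum_filter, ← Finset.sum_sub_distrib]
    refine Finset.sum_congr rfl fun l _ => ?_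
    unfold ordSign
    rcases lt_trichotomy k l with h | h | h
    · simp [h, h.not_gt]
      ring
    · simp [h]
    · simp [h, h.not_gt]
      ring
  have h2 : pencilWeight t x k = Complex.normSq (x k) / 2 + (∑ l with k < l, Complex.normSq (x l)) -
      t * ∑ l, Complex.normSq (x l) := by
    have h3 : Complex.normSq (x k) / 2 = ∑ l, if l = k then Complex.normSq (x l) / 2 else 0 := by
      simp
    rw [pencilWeight, Finset.sum_filter, Finset.mul_sum, h3, ← Finset.sum_add_distrib,
      ← Finset.sum_sub_distrib]
    refine Finset.sum_congr rfl fun l _ => ?_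
    unfold ordSign
    rcases lt_trichotomy k l with h | h | h
    · simp [h, h.ne']
      ring
    · simp [h]
      ring
    · simp [h, h.ne, h.not_gt]
  rw [pencilSharp, bruhatSharp, fubiniStudySharp, mul_assoc (I / 2), h1, h2]
  push_cast
  ring

theorem pencil_mk {n : ℕ} (t : ℝ) (f g : C n) {x : Fin (n + 1) → ℂ} (hx : x ≠ 0) :
    (pencil n t f g : CP n → ℝ) (Projectivization.mk ℂ x hx) =
      2 * ∑ k, (wirtinger (lift (g : CP n → ℝ)) x k *
        pencilSharp t x (wirtinger (lift (f : CP n → ℝ)) x) k).re := by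
  simp only [pencil, LinearMap.add_apply, LinearMap.smul_apply, Derivation.add_apply,
    Derivation.smul_apply, C.coe_add, C.coe_smul, Pi.add_apply, Pi.smul_apply, smul_eq_mul]
  rw [bruhat, fubiniStudy, descendBivector_mk, descendBivector_mk, mul_left_comm t, ← mul_add,
    Finset.mul_sum, ← Finset.sum_add_distrib]
  congr 1
  refine Finset.sum_congr rfl fun k _ => ?_
  rw [pencilSharp_eq, mul_add, Complex.add_re, mul_left_comm _ (t : ℂ), Complex.re_ofReal_mul]

theorem pencil_mk' {n : ℕ} (t : ℝ) (f g : C n) {x : Fin (n + 1) → ℂ} (hx : x ≠ 0) :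
    (pencil n t f g : CP n → ℝ) (Projectivization.mk ℂ x hx) =
      fderiv ℝ (lift (g : CP n → ℝ)) x
        (pencilSharp t x (wirtinger (lift (f : CP n → ℝ)) x)) := by
  rw [pencil_mk, fderiv_eq_wirtinger]

theorem fundamental_diagonal_mk {n : ℕ} (θ : Fin (n + 1) → ℝ) (f : C n) {x : Fin (n + 1) → ℂ}
    (hx : x ≠ 0) :
    (fundamental (Matrix.diagonal fun l => I * (θ l : ℂ)) f : CP n → ℝ)
      (Projectivization.mk ℂ x hx) =
      fderiv ℝ (lift (f : CP n → ℝ)) x fun k => I * θ k * x k := by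
  rw [fundamental, descend_mk]
  congr 1
  ext k
  rw [Matrix.vecMul_diagonal, mul_comm]

/-! ### The diagonal torus preserves the pencil -/

/-- The second derivative of a smooth function in homogeneous coordinates. -/
theorem hasFDerivAt_fderiv_lift {n : ℕ} (f : C n) {x : Fin (n + 1) → ℂ} (hx : x ≠ 0) :
    HasFDerivAt (fderiv ℝ (lift (f : CP n → ℝ))) (fderiv ℝ (fderiv ℝ (lift (f : CP n → ℝ))) x) x :=
  (((contDiffAt_lift f hx).fderiv_right (m := 1)
    (by norm_cast)).differentiableAt (by simp)).hasFDerivAt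

theorem fderiv_fderiv_lift_symm {n : ℕ} (f : C n) {x : Fin (n + 1) → ℂ} (hx : x ≠ 0)
    (u v : Fin (n + 1) → ℂ) :
    fderiv ℝ (fderiv ℝ (lift (f : CP n → ℝ))) x u v =
      fderiv ℝ (fderiv ℝ (lift (f : CP n → ℝ))) x v u := by
  have h : IsSymmSndFDerivAt ℝ (lift (f : CP n → ℝ)) x :=
    (contDiffAt_lift f hx).isSymmSndFDerivAt (by simp; exact WithTop.coe_le_coe.2 le_top)
  exact h u v

theorem hasFDerivAt_fderiv_lift_apply {n : ℕ} (f : C n) {x : Fin (n + 1) → ℂ} (hx : x ≠ 0)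
    (u : Fin (n + 1) → ℂ) :
    HasFDerivAt (fun y => fderiv ℝ (lift (f : CP n → ℝ)) y u)
      ((fderiv ℝ (fderiv ℝ (lift (f : CP n → ℝ))) x).flip u) x := by
  have := (hasFDerivAt_fderiv_lift f hx).clm_apply (hasFDerivAt_const u x)
  simpa using this

theorem differentiableAt_wirtinger_lift {n : ℕ} (f : C n) {x : Fin (n + 1) → ℂ} (hx : x ≠ 0)
    (k : Fin (n + 1)) :
    DifferentiableAt ℝ (fun y => wirtinger (lift (f : CP n → ℝ)) y k) x := by
  have h : ∀ u, DifferentiableAt ℝ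
      (fun y => ((fderiv ℝ (lift (f : CP n → ℝ)) y u : ℝ) : ℂ)) x := fun u =>
    Complex.ofRealCLM.differentiableAt.comp x (hasFDerivAt_fderiv_lift_apply f hx u).differentiableAt
  exact ((h _).sub ((h _).const_mul I)).const_mul (1 / 2 : ℂ)

theorem fderiv_wirtinger_lift {n : ℕ} (f : C n) {x : Fin (n + 1) → ℂ} (hx : x ≠ 0)
    (k : Fin (n + 1)) (v : Fin (n + 1) → ℂ) :
    fderiv ℝ (fun y => wirtinger (lift (f : CP n → ℝ)) y k) x v =
      1 / 2 * ((fderiv ℝ (fderiv ℝ (lift (f : CP n → ℝ))) x v (Pi.single k 1) : ℂ) -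
        I * (fderiv ℝ (fderiv ℝ (lift (f : CP n → ℝ))) x v (Pi.single k I) : ℂ)) := by
  have h : ∀ u, HasFDerivAt (fun y => ((fderiv ℝ (lift (f : CP n → ℝ)) y u : ℝ) : ℂ))
      (Complex.ofRealCLM.comp ((fderiv ℝ (fderiv ℝ (lift (f : CP n → ℝ))) x).flip u)) x := fun u =>
    Complex.ofRealCLM.hasFDerivAt.comp x (hasFDerivAt_fderiv_lift_apply f hx u)
  have h2 : HasFDerivAt (fun y => wirtinger (lift (f : CP n → ℝ)) y k) _ x :=
    ((h (Pi.single k 1)).sub ((h (Pi.single k I)).const_mul I)).const_mul (1 / 2 : ℂ)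
  rw [h2.fderiv]
  simp

/-- The infinitesimal action of the diagonal torus on differentials: `∂_k (σ f)` is the derivative
of `∂_k f` along `σ`, twisted by the weight of `X_k`. -/
theorem wirtinger_lift_fundamental {n : ℕ} (θ : Fin (n + 1) → ℝ) (f : C n)
    {x : Fin (n + 1) → ℂ} (hx : x ≠ 0) (k : Fin (n + 1)) :
    wirtinger (lift (fundamental (Matrix.diagonal fun l => I * (θ l : ℂ)) f : CP n → ℝ)) x k =
      fderiv ℝ (fun y => wirtinger (lift (f : CP n → ℝ)) y k) x (fun l => I * θ l * x l) +
        I * θ k * wirtinger (lift (f : CP n → ℝ)) x k := by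
  let A : (Fin (n + 1) → ℂ) →L[ℝ] (Fin (n + 1) → ℂ) :=
    ContinuousLinearMap.pi fun k => ((I * θ k) • ContinuousLinearMap.proj (R := ℂ)
      (φ := fun _ : Fin (n + 1) => ℂ) k).restrictScalars ℝ
  have hA : ∀ y, A y = fun l => I * θ l * y l := fun y => rfl
  have e : lift (fundamental (Matrix.diagonal fun l => I * (θ l : ℂ)) f : CP n → ℝ) =ᶠ[nhds x]
      fun y => fderiv ℝ (lift (f : CP n → ℝ)) y (A y) := by
    filter_upwards [isOpen_ne.mem_nhds hx] with y hy
    rw [lift_of_ne _ hy, fundamental_diagonal_mk]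
    rfl
  have h := (hasFDerivAt_fderiv_lift f hx).clm_apply A.hasFDerivAt (x := x)
  have hs : ∀ c : ℂ, A (Pi.single k c) = Pi.single k (I * θ k * c) := fun c => by
    rw [hA]
    ext l
    by_cases hl : l = k
    · subst hl; simp
    · simp [hl]
  rw [wirtinger, e.fderiv_eq, h.fderiv, fderiv_wirtinger_lift f hx, wirtinger]
  simp only [_root_.add_apply, ContinuousLinearMap.comp_apply,
    ContinuousLinearMap.flip_apply, hs, hA]
  rw [fderiv_fderiv_lift_symm f hx (Pi.single k 1), fderiv_fderiv_lift_symm f hx (Pi.single k I),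
    fderiv_single _ k (I * θ k * 1), fderiv_single _ k (I * θ k * I)]
  apply Complex.ext
  · simp
    ring
  · simp
    ring

/-- The diagonal torus acts by Poisson automorphisms of every member of the pencil. -/
theorem fundamental_diagonal_mem_poissonVectorFields {n : ℕ} (t : ℝ) (θ : Fin (n + 1) → ℝ) :
    fundamental (Matrix.diagonal fun l => I * (θ l : ℂ)) ∈ poissonVectorFields (pencil n t) := by
  intro f g
  ext p
  induction p using Projectivization.ind with
  | h x hx =>
    set σ := fundamental (Matrix.diagonal fun l => I * (θ l : ℂ)) with hσ
    rw [C.coe_add, Pi.add_apply, pencil_mk, pencil_mk, hσ, fundamental_diagonal_mk, ← hσ]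
    set v : Fin (n + 1) → ℂ := fun l => I * θ l * x l with hv
    have h1 := hasDerivAt_comp_line (differentiableAt_lift (pencil n t f g) hx) v
    have h2 : (fun s : ℝ => lift (pencil n t f g : CP n → ℝ) (x + s • v)) =ᶠ[nhds 0] fun s =>
        2 * ∑ k, (wirtinger (lift (g : CP n → ℝ)) (x + s • v) k *
          pencilSharp t (x + s • v) (wirtinger (lift (f : CP n → ℝ)) (x + s • v)) k).re := by
      filter_upwards [eventually_line_ne_zero hx v] with s hs
      rw [lift_of_ne _ hs, pencil_mk]
    have hF := fun k => hasDerivAt_comp_line (differentiableAt_wirtinger_lift f hx k) v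
    have hG := fun k => hasDerivAt_comp_line (differentiableAt_wirtinger_lift g hx k) v
    have hX := fun k => hasDerivAt_coord_line x v k
    have hW : ∀ k, HasDerivAt (fun s : ℝ => pencilWeight t (x + s • v) k) 0 0 := fun k => by
      have := HasDerivAt.fun_sum (u := Finset.univ) fun l _ =>
        (hasDerivAt_normSq (hX l)).const_mul ((1 + ordSign k l) / 2 - t)
      refine this.congr_deriv (Finset.sum_eq_zero fun l _ => ?_)
      simp [hv]
      ring_nf
      simp
    have hA : ∀ k, HasDerivAt (fun s : ℝ => ∑ l, (ordSign k l : ℂ) * ((x + s • v) l *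
        wirtinger (lift (f : CP n → ℝ)) (x + s • v) l)) _ 0 := fun k =>
      HasDerivAt.fun_sum (u := Finset.univ) fun l _ =>
        ((hX l).mul (hF l)).const_mul (ordSign k l : ℂ)
    have hY : ∀ k, HasDerivAt (fun s : ℝ => pencilSharp t (x + s • v)
        (wirtinger (lift (f : CP n → ℝ)) (x + s • v)) k) _ 0 := fun k =>
      (((hA k).const_mul (I / 2)).mul (hX k)).sub
        (((hW k).ofReal_comp.const_mul I).mul (hasDerivAt_conj (hF k)))
    have h3 := ((HasDerivAt.fun_sum (u := Finset.univ) fun k _ =>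
      hasDerivAt_re ((hG k).mul (hY k))).const_mul 2).congr_of_eventuallyEq h2
    rw [h1.unique h3, ← mul_add, ← Finset.sum_add_distrib]
    congr 1
    refine Finset.sum_congr rfl fun k _ => ?_
    rw [← Complex.add_re]
    congr 1
    have hF' : ∀ l, wirtinger (lift (σ f : CP n → ℝ)) x l = _ := wirtinger_lift_fundamental θ f hx
    have hG' : ∀ l, wirtinger (lift (σ g : CP n → ℝ)) x l = _ := wirtinger_lift_fundamental θ g hx
    have hS : ∑ l, (ordSign k l : ℂ) * (x l * wirtinger (lift (σ f : CP n → ℝ)) x l) =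
        ∑ l, (ordSign k l : ℂ) * (v l * wirtinger (lift (f : CP n → ℝ)) x l +
          x l * fderiv ℝ (fun y => wirtinger (lift (f : CP n → ℝ)) y l) x v) :=
      Finset.sum_congr rfl fun l _ => by rw [hF' l, hv]; ring
    simp only [pencilSharp, zero_smul, add_zero, hS]
    rw [hF' k, hG' k, ← hv]
    simp only [map_add, map_mul, Complex.conj_I, Complex.conj_ofReal]
    have hvk : v k = I * θ k * x k := rfl
    rw [hvk]
    push_cast
    ring

/-! ### The modular class does not vanish -/

/-- If the Hamiltonian vector field of `f` is the fundamental vector field of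
`i diag (n/2 - l)`, then at the points of the line through the last two coordinate points, the
number `a = X_{n+1} ∂f/∂X_{n+1}` satisfies `ā |X|² (|X_{n+1}|² - t |X|²) = |X_n|² |X_{n+1}|²`. -/
theorem hamiltonian_on_last_line {m : ℕ} {t : ℝ} {f : C (m + 1)}
    (hf : pencil (m + 1) t f = fundamental (halfSumPositiveRoots (m + 1)))
    {x : Fin (m + 2) → ℂ} (hx : x ≠ 0) (h0 : ∀ i : Fin m, x i.castSucc.castSucc = 0) :
    conj (x (Fin.last (m + 1)) * wirtinger (lift (f : CP (m + 1) → ℝ)) x (Fin.last (m + 1))) *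
      ((Complex.normSq (x (Fin.last m).castSucc) +
          Complex.normSq (x (Fin.last (m + 1))) : ℝ) *
        (Complex.normSq (x (Fin.last (m + 1))) - t *
          (Complex.normSq (x (Fin.last m).castSucc) +
            Complex.normSq (x (Fin.last (m + 1)))) : ℝ)) =
      Complex.normSq (x (Fin.last m).castSucc) * Complex.normSq (x (Fin.last (m + 1))) := by
  set α := wirtinger (lift (f : CP (m + 1) → ℝ)) x with hα
  have hE := sum_wirtinger_lift f hx
  obtain ⟨μ, hμ⟩ := exists_eq_smul_of_fderiv_lift_eq_zero hx (v := pencilSharp t x α -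
    fun k : Fin (m + 2) => I * (((m + 1 : ℕ) : ℝ) / 2 - (k : ℕ) : ℝ) * x k) fun g => by
      rw [map_sub, ← fundamental_diagonal_mk _ g hx, ← halfSumPositiveRoots_eq_diagonal, ← hf,
        pencil_mk', sub_self]
  have h1 := congrFun hμ (Fin.last m).castSucc
  have h2 := congrFun hμ (Fin.last (m + 1))
  have hlt : (Fin.last m).castSucc < Fin.last (m + 1) := Fin.castSucc_lt_last _
  rw [← hα] at hE
  simp only [Fin.sum_univ_castSucc, h0, zero_mul, Finset.sum_const_zero, zero_add] at hE
  simp only [pencilSharp, pencilWeight, Pi.sub_apply, Pi.smul_apply, smul_eq_mul,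
    Fin.sum_univ_castSucc, h0, zero_mul, mul_zero, Finset.sum_const_zero, zero_add, map_zero,
    ordSign_self, ordSign_swap (Fin.last m).castSucc (Fin.last (m + 1))] at h1 h2
  rw [show ordSign (Fin.last m).castSucc (Fin.last (m + 1)) = 1 by simp [ordSign, hlt]] at h1 h2
  simp only [Fin.val_castSucc, Fin.val_last] at h1 h2
  generalize x (Fin.last m).castSucc = u at *
  generalize x (Fin.last (m + 1)) = w at *
  generalize α (Fin.last m).castSucc = β at *
  generalize α (Fin.last (m + 1)) = γ at *
  have hE' : conj u * conj β + conj w * conj γ = 0 := by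
    simpa using congrArg conj hE
  push_cast at h1 h2 ⊢
  simp only [← Complex.mul_conj] at *
  simp only [map_mul]
  -- eliminate `μ` from the two components, multiplied by `ū w w̄` and `w̄ u ū`
  linear_combination -I * (conj u * w * conj w * h1 - conj w * u * conj u * h2) -
    u * conj u * (w * conj w) / 2 * hE +
    ((1 / 2 - t) * (u * conj u) + (1 - t) * (w * conj w)) * (w * conj w) * hE' +
    (u * conj u * (w * conj w) * ((u * β + w * γ) / 2 - 1) -
      ((1 / 2 - t) * (u * conj u) + (1 - t) * (w * conj w)) * (w * conj w) * (conj u * conj β) +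
      (-t * (u * conj u) + (1 / 2 - t) * (w * conj w)) * (u * conj u) * (conj w * conj γ)) *
        Complex.I_sq

/-- For `t ∈ [0, 1]` the fundamental vector field of the half-sum of the positive roots is not
Hamiltonian. -/
theorem fundamental_halfSum_not_hamiltonian {m : ℕ} {t : ℝ} (ht : t ∈ Set.Icc (0 : ℝ) 1)
    (f : C (m + 1)) : pencil (m + 1) t f ≠ fundamental (halfSumPositiveRoots (m + 1)) := by
  intro hf
  set k : Fin (m + 2) := (Fin.last m).castSucc with hk
  set l : Fin (m + 2) := Fin.last (m + 1) with hl
  have hkl : k ≠ l := (Fin.castSucc_lt_last _).ne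
  have hik : ∀ i : Fin m, i.castSucc.castSucc ≠ k := fun i h =>
    (Fin.castSucc_lt_last i).ne (Fin.castSucc_injective _ h)
  have hil : ∀ i : Fin m, i.castSucc.castSucc ≠ l := fun i => (Fin.castSucc_lt_last _).ne
  -- the line through the last two coordinate points
  let P : ℝ → ℝ → Fin (m + 2) → ℂ := fun r s => Pi.single k (r : ℂ) + Pi.single l (s : ℂ)
  have Pk : ∀ r s, P r s k = r := fun r s => by simp [P, hkl]
  have Pl : ∀ r s, P r s l = s := fun r s => by simp [P, hkl.symm]
  have P0 : ∀ r s (i : Fin m), P r s i.castSucc.castSucc = 0 := fun r s i => by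
    simp [P, hik i, hil i]
  have hP : Continuous fun q : ℝ × ℝ => P q.1 q.2 := by
    refine continuous_pi fun i => ?_
    simp only [P, Pi.add_apply, Pi.single_apply]
    split_ifs <;> fun_prop
  let a : ℝ → ℝ → ℂ := fun r s => conj (P r s l * wirtinger (lift (f : CP (m + 1) → ℝ)) (P r s) l)
  have key : ∀ r s, P r s ≠ 0 →
      a r s * ((r ^ 2 + s ^ 2) * (s ^ 2 - t * (r ^ 2 + s ^ 2)) : ℝ) = (r ^ 2 * s ^ 2 : ℝ) :=
    fun r s h => by
    have := hamiltonian_on_last_line hf h (P0 r s)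
    rw [← hk, ← hl] at this
    simp only [Pk, Pl, Complex.normSq_ofReal] at this
    simp only [a, Pl]
    push_cast at this ⊢
    linear_combination this
  have hk0 : ∀ s, P 1 s ≠ 0 := fun s h => by simpa [Pk] using congrFun h k
  have hl0 : ∀ r, P r 1 ≠ 0 := fun r h => by simpa [Pl] using congrFun h l
  have hcont : ∀ r s, P r s ≠ 0 → ContinuousAt (fun q : ℝ × ℝ => a q.1 q.2) (r, s) :=
    fun r s h => by
    have h1 : ContinuousAt (fun q : ℝ × ℝ => wirtinger (lift (f : CP (m + 1) → ℝ)) (P q.1 q.2) l)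
        (r, s) := ContinuousAt.comp (g := fun y => wirtinger (lift (f : CP (m + 1) → ℝ)) y l)
          (differentiableAt_wirtinger_lift f h l).continuousAt hP.continuousAt
    have h2 : ContinuousAt (fun q : ℝ × ℝ => P q.1 q.2 l) (r, s) :=
      ((continuous_apply l).comp hP).continuousAt
    exact Complex.continuous_conj.continuousAt.comp (h2.mul h1)
  rcases ht.1.eq_or_lt with rfl | ht0
  · -- `t = 0`: off the last coordinate point `a = |X_n|²/|X|² → 1`, although `a` vanishes there
    have h1 : ∀ s : ℝ, s ≠ 0 → a 1 s * (1 + s ^ 2 : ℝ) = 1 := fun s hs => by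
      have := key 1 s (hk0 s)
      have hs' : (s : ℂ) ≠ 0 := by exact_mod_cast hs
      push_cast at this ⊢
      apply mul_left_cancel₀ (pow_ne_zero 2 hs')
      linear_combination this
    have h2 : ContinuousAt (fun s : ℝ => a 1 s * (1 + s ^ 2 : ℝ)) 0 :=
      ((hcont 1 0 (hk0 0)).comp (f := fun s : ℝ => ((1 : ℝ), s)) (by fun_prop)).mul (by fun_prop)
    have h3 : Filter.Tendsto (fun s : ℝ => a 1 s * (1 + s ^ 2 : ℝ)) (nhdsWithin 0 {0}ᶜ)
        (nhds 1) := tendsto_const_nhds.congr' (by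
          filter_upwards [self_mem_nhdsWithin] with s hs using (h1 s hs).symm)
    have h4 := tendsto_nhds_unique (h2.tendsto.mono_left nhdsWithin_le_nhds) h3
    simp [a, Pl] at h4
  rcases ht.2.eq_or_lt with rfl | ht1
  · -- `t = 1`: the same at the point where `X_n = 0`, with `a = -|X_{n+1}|²/|X|²`
    have h1 : ∀ r : ℝ, r ≠ 0 → a r 1 * (r ^ 2 + 1 : ℝ) = -1 := fun r hr => by
      have := key r 1 (hl0 r)
      have hr' : (r : ℂ) ≠ 0 := by exact_mod_cast hr
      push_cast at this ⊢
      apply mul_left_cancel₀ (pow_ne_zero 2 hr')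
      linear_combination -this
    have h2 : ContinuousAt (fun r : ℝ => a r 1 * (r ^ 2 + 1 : ℝ)) 0 :=
      ((hcont 0 1 (hl0 0)).comp (f := fun r : ℝ => (r, (1 : ℝ))) (by fun_prop)).mul (by fun_prop)
    have h3 : Filter.Tendsto (fun r : ℝ => a r 1 * (r ^ 2 + 1 : ℝ)) (nhdsWithin 0 {0}ᶜ)
        (nhds (-1)) := tendsto_const_nhds.congr' (by
          filter_upwards [self_mem_nhdsWithin] with s hs using (h1 s hs).symm)
    have h4 := tendsto_nhds_unique (h2.tendsto.mono_left nhdsWithin_le_nhds) h3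
    have h5 := sum_wirtinger_lift f (hl0 0)
    rw [Fin.sum_univ_castSucc, Fin.sum_univ_castSucc, ← hk, ← hl] at h5
    simp only [P0, Pk, Complex.ofReal_zero, zero_mul, Finset.sum_const_zero, zero_add] at h5
    have h6 : a 0 1 = 0 := by simp only [a, h5, map_zero]
    simp [h6] at h4
  · -- `0 < t < 1`: the bivector field vanishes on the circle `|X_{n+1}|² = t |X|²`
    have h1 : (√(1 - t)) ^ 2 = 1 - t := Real.sq_sqrt (by linarith)
    have h2 : (√t) ^ 2 = t := Real.sq_sqrt ht0.le
    have h3 := key (√(1 - t)) (√t) fun h => by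
      have := congrFun h l
      rw [Pl, Pi.zero_apply, Complex.ofReal_eq_zero] at this
      exact (Real.sqrt_pos.2 ht0).ne' this
    rw [h1, h2, show (1 - t + t) * (t - t * (1 - t + t)) = 0 by ring, Complex.ofReal_zero,
      mul_zero, eq_comm, Complex.ofReal_eq_zero] at h3
    have : 0 < (1 - t) * t := mul_pos (by linarith) ht0
    exact this.ne' h3

/-! ### The Fubini-Study volume form -/

/-- The real basis of `ℂⁿ` formed by the coordinate frame `realFrame`. -/
def realBasis (n : ℕ) : Module.Basis (Fin n × Fin 2) ℝ (Fin n → ℂ) :=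
  (Pi.basis fun _ : Fin n => Complex.basisOneI).reindex (Equiv.sigmaEquivProd _ _)

theorem realBasis_apply {n : ℕ} (a : Fin n × Fin 2) : realBasis n a = realFrame a := by
  obtain ⟨i, b⟩ := a
  rw [realBasis, Module.Basis.reindex_apply, Equiv.sigmaEquivProd_symm_apply, Pi.basis_apply,
    Complex.coe_basisOneI]
  fin_cases b <;> simp [realFrame]

theorem realBasis_repr {n : ℕ} (v : Fin n → ℂ) (a : Fin n × Fin 2) :
    (realBasis n).repr v a = if a.2 = 0 then (v a.1).re else (v a.1).im := by
  obtain ⟨i, b⟩ := a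
  rw [realBasis, Module.Basis.repr_reindex_apply, Equiv.sigmaEquivProd_symm_apply, Pi.basis_repr,
    Complex.coe_basisOneI_repr]
  fin_cases b <;> simp

theorem prod_pair_update {ι M : Type*} [Fintype ι] [DecidableEq ι] [DecidableEq (ι × Fin 2)]
    (Ω : M → M → ℝ) (v : ι × Fin 2 → M) (i : ι) (b : Fin 2) (w : M) :
    ∏ k, Ω (Function.update v (i, b) w (k, 0)) (Function.update v (i, b) w (k, 1)) =
      Ω (Function.update v (i, b) w (i, 0)) (Function.update v (i, b) w (i, 1)) *
        ∏ k ∈ Finset.univ.erase i, Ω (v (k, 0)) (v (k, 1)) := by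
  rw [← Finset.mul_prod_erase _ _ (Finset.mem_univ i)]
  congr 1
  refine Finset.prod_congr rfl fun k hk => ?_
  have := Finset.ne_of_mem_erase hk
  rw [Function.update_of_ne (by simp [this]), Function.update_of_ne (by simp [this])]

/-- The multilinear map `v ↦ ∏_i Ω(v_{i,0}, v_{i,1})`, whose alternatization is a multiple of the
top power of `Ω`. -/
def pairProduct {n : ℕ} (Ω : (Fin n → ℂ) →ₗ[ℝ] (Fin n → ℂ) →ₗ[ℝ] ℝ) :
    MultilinearMap ℝ (fun _ : Fin n × Fin 2 => Fin n → ℂ) ℝ where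
  toFun v := ∏ i, Ω (v (i, 0)) (v (i, 1))
  map_update_add' v p x y := by
    obtain ⟨i, b⟩ := p
    simp only [prod_pair_update (fun u v => Ω u v)]
    rw [← add_mul]
    congr 1
    fin_cases b <;> simp
  map_update_smul' v p c x := by
    obtain ⟨i, b⟩ := p
    simp only [prod_pair_update (fun u v => Ω u v)]
    rw [smul_eq_mul, ← mul_assoc]
    congr 1
    fin_cases b <;> simp

/-- Under a linear map the top power of a two-form is multiplied by the determinant. -/
theorem topPower_comp {n : ℕ} (Ω : (Fin n → ℂ) →ₗ[ℝ] (Fin n → ℂ) →ₗ[ℝ] ℝ)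
    (A : (Fin n → ℂ) →ₗ[ℝ] Fin n → ℂ) :
    topPower (fun u v => Ω (A u) (A v)) realFrame =
      LinearMap.det A * topPower (fun u v => Ω u v) realFrame := by
  have h : ∀ v, topPower (fun u v => Ω u v) v =
      (1 / ((n.factorial : ℝ) * 2 ^ n)) * MultilinearMap.alternatization (pairProduct Ω) v :=
    fun v => by
      rw [topPower, MultilinearMap.alternatization_apply]
      congr 1
      refine Finset.sum_congr rfl fun s _ => ?_
      rw [Units.smul_def, zsmul_eq_mul]
      rfl
  have e : (realFrame : Fin n × Fin 2 → Fin n → ℂ) = realBasis n :=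
    funext fun a => (realBasis_apply a).symm
  have h1 : topPower (fun u v => Ω (A u) (A v)) realFrame =
      topPower (fun u v => Ω u v) (A ∘ realFrame) := rfl
  rw [h1, h, h, e, (MultilinearMap.alternatization (pairProduct Ω)).eq_smul_basis_det (realBasis n)]
  simp only [AlternatingMap.smul_apply, smul_eq_mul, Module.Basis.det_comp, Module.Basis.det_self]
  ring

/-- The standard form `u, v ↦ 2 Im ∑ u_a v̄_a`, the Fubini-Study form at the origin of a chart. -/
def stdForm (n : ℕ) : (Fin n → ℂ) →ₗ[ℝ] (Fin n → ℂ) →ₗ[ℝ] ℝ :=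
  LinearMap.mk₂ ℝ (fun u v => 2 * (∑ a, u a * conj (v a)).im)
    (fun u u' v => by simp [add_mul, Finset.sum_add_distrib]; ring)
    (fun r u v => by simp [mul_assoc, ← Finset.mul_sum]; ring)
    (fun u v v' => by simp [mul_add, Finset.sum_add_distrib])
    (fun r u v => by simp [mul_left_comm _ (r : ℂ), ← Finset.mul_sum]; ring)

theorem stdForm_apply {n : ℕ} (u v : Fin n → ℂ) :
    stdForm n u v = 2 * (∑ a, u a * conj (v a)).im := rfl

theorem stdForm_realFrame {n : ℕ} (i k : Fin n) (b c : Fin 2) :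
    stdForm n (realFrame (i, b)) (realFrame (k, c)) =
      if i = k then 2 * ((if b = 0 then 1 else I) * conj (if c = 0 then 1 else I)).im else 0 := by
  rw [stdForm_apply]
  simp only [realFrame]
  by_cases h : i = k
  · subst h
    rw [if_pos rfl, Finset.sum_eq_single i]
    · simp
    · intro a _ ha
      simp [ha]
    · simp
  · rw [if_neg h, Finset.sum_eq_zero]
    · simp
    · intro a _
      by_cases ha : a = i
      · subst ha
        simp [h]
      · simp [ha]

/-- Every permutation contributes to the top power of the standard form with the same sign: it
contributes only if it permutes the coordinate planes `{Re z_i, Im z_i}`, and then its sign is the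
product of the orientations of its restrictions to these planes. -/
theorem sign_mul_prod_stdForm_eq {n : ℕ} (s : Equiv.Perm (Fin n × Fin 2))
    (h : ∀ i, (s (i, 0)).1 = (s (i, 1)).1) :
    ((Equiv.Perm.sign s : ℤ) : ℝ) * ∏ i, stdForm n (realFrame (s (i, 0))) (realFrame (s (i, 1))) =
      (-2) ^ n := by
  have h1 : ∀ i b, (s (i, b)).1 = (s (i, 0)).1 := fun i b => by
    fin_cases b
    · rfl
    · exact (h i).symm
  have hτ : Function.Surjective fun i => (s (i, 0)).1 := fun a => by
    refine ⟨(s.symm (a, 0)).1, ?_⟩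
    change (s ((s.symm (a, 0)).1, 0)).1 = a
    rw [← h1 _ (s.symm (a, 0)).2, Prod.mk.eta, Equiv.apply_symm_apply]
  let τ : Equiv.Perm (Fin n) := Equiv.ofBijective _ (Finite.surjective_iff_bijective.1 hτ)
  have hσ : ∀ i, Function.Injective fun b => (s (i, b)).2 := fun i b c hbc => by
    have : s (i, b) = s (i, c) := Prod.ext ((h1 i b).trans (h1 i c).symm) hbc
    simpa using s.injective this
  let σ : Fin n → Equiv.Perm (Fin 2) := fun i =>
    Equiv.ofBijective _ (Finite.injective_iff_bijective.1 (hσ i))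
  have hs : s = Equiv.prodCongrLeft (fun _ => τ) * Equiv.prodCongrRight σ := by
    ext1 ⟨i, b⟩
    exact Prod.ext (h1 i b) rfl
  have hsign : Equiv.Perm.sign s = ∏ i, Equiv.Perm.sign (σ i) := by
    rw [hs, Equiv.Perm.sign_mul, Equiv.Perm.sign_prodCongrLeft, Equiv.Perm.sign_prodCongrRight]
    simp
  have hplane : ∀ ρ : Equiv.Perm (Fin 2), 2 * ((if ρ 0 = 0 then (1 : ℂ) else I) *
      conj (if ρ 1 = 0 then (1 : ℂ) else I)).im = -2 * ((Equiv.Perm.sign ρ : ℤ) : ℝ) := by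
    intro ρ
    have : ρ = 1 ∨ ρ = Equiv.swap 0 1 := by
      revert ρ
      decide
    rcases this with rfl | rfl
    · simp
    · simp
  have hterm : ∀ i, stdForm n (realFrame (s (i, 0))) (realFrame (s (i, 1))) =
      -2 * ((Equiv.Perm.sign (σ i) : ℤ) : ℝ) := fun i => by
    rw [← hplane, ← Prod.mk.eta (p := s (i, 0)), ← Prod.mk.eta (p := s (i, 1)), stdForm_realFrame,
      if_pos (h i)]
    rfl
  rw [Finset.prod_congr rfl fun i _ => hterm i, Finset.prod_mul_distrib, hsign]
  push_cast
  rw [mul_left_comm, ← Finset.prod_mul_distrib, Finset.prod_eq_one (f := fun i =>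
    ((Equiv.Perm.sign (σ i) : ℤ) : ℝ) * ((Equiv.Perm.sign (σ i) : ℤ) : ℝ))]
  · simp
  · intro i _
    rw [← Int.cast_mul, ← Units.val_mul, Int.units_mul_self]
    simp

theorem topPower_stdForm_ne_zero (n : ℕ) :
    topPower (fun u v => stdForm n u v) realFrame ≠ 0 := by
  have h : ∀ s : Equiv.Perm (Fin n × Fin 2), ((Equiv.Perm.sign s : ℤ) : ℝ) *
      ∏ i, stdForm n (realFrame (s (i, 0))) (realFrame (s (i, 1))) =
      (-2) ^ n * if ∀ i, (s (i, 0)).1 = (s (i, 1)).1 then 1 else 0 := fun s => by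
    split_ifs with hs
    · rw [sign_mul_prod_stdForm_eq s hs, mul_one]
    · push Not at hs
      obtain ⟨i, hi⟩ := hs
      rw [Finset.prod_eq_zero (Finset.mem_univ i), mul_zero, mul_zero]
      rw [← Prod.mk.eta (p := s (i, 0)), ← Prod.mk.eta (p := s (i, 1)), stdForm_realFrame,
        if_neg hi]
  rw [topPower]
  refine mul_ne_zero (by positivity) ?_
  rw [Finset.sum_congr rfl fun s _ => h s, ← Finset.mul_sum]
  refine mul_ne_zero (by positivity) (ne_of_gt ?_)
  refine Finset.sum_pos' (fun s _ => by split_ifs <;> norm_num) ⟨1, Finset.mem_univ _, ?_⟩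
  simp

/-- The Fubini-Study volume is a nonzero multiple of `(1 + |z|²)^{-(n+1)}` times the Euclidean
one. -/
theorem fubiniStudyVolume_eq {n : ℕ} (j : Fin (n + 1)) (z : Fin n → ℂ) :
    fubiniStudyVolume n j z = topPower (fun u v => stdForm n u v) realFrame *
      ((1 + ∑ a, Complex.normSq (z a)) ^ (n + 1))⁻¹ := by
  set r := ∑ a, Complex.normSq (z a) with hr
  have hr0 : 0 ≤ r := Finset.sum_nonneg fun a _ => Complex.normSq_nonneg _
  set q := √(1 + r) with hq
  have hq0 : 0 < q := Real.sqrt_pos.2 (by linarith)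
  have hq2 : q ^ 2 = 1 + r := Real.sq_sqrt (by linarith)
  have hqC : (q : ℂ) ≠ 0 := by exact_mod_cast hq0.ne'
  have hqC1 : (q : ℂ) + 1 ≠ 0 := by exact_mod_cast (by linarith : q + 1 ≠ 0)
  have hq2C : (q : ℂ) ^ 2 = 1 + r := by exact_mod_cast hq2
  have hz : ∑ a, z a * conj (z a) = (r : ℂ) := by
    rw [hr, Complex.ofReal_sum]
    exact Finset.sum_congr rfl fun a _ => Complex.mul_conj _
  -- the matrix `A` with `A A* = (N - z̄ zᵗ) / N²`, `N = 1 + |z|² = q²`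
  set c : ℂ := 1 / (q * (q + 1)) with hc
  set M : Matrix (Fin n) (Fin n) ℂ := (q : ℂ)⁻¹ • (1 + Matrix.replicateCol Unit (-c • z) *
    Matrix.replicateRow Unit (fun a => conj (z a))) with hM
  have hA : ∀ u a, M.toLin' u a = (q : ℂ)⁻¹ * (u a - c * (∑ b, u b * conj (z b)) * z a) := by
    intro u a
    have : (Matrix.replicateCol Unit (-c • z) *
        Matrix.replicateRow Unit (fun a => conj (z a))).mulVec u a =
        -c * z a * ∑ b, u b * conj (z b) := by
      simp only [Matrix.mulVec, dotProduct, Matrix.mul_apply, Matrix.replicateCol_apply,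
        Matrix.replicateRow_apply, Finset.univ_unique, Finset.sum_singleton, Pi.smul_apply,
        smul_eq_mul, Finset.mul_sum]
      exact Finset.sum_congr rfl fun b _ => by ring
    rw [Matrix.toLin'_apply, hM, Matrix.smul_mulVec, Matrix.add_mulVec, Matrix.one_mulVec,
      Pi.smul_apply, Pi.add_apply, this, smul_eq_mul]
    ring
  have hform : fubiniStudyForm z = fun u v =>
      stdForm n (M.toLin'.restrictScalars ℝ u) (M.toLin'.restrictScalars ℝ v) := by
    ext u v
    rw [stdForm_apply, fubiniStudyForm, mul_div_assoc]
    congr 1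
    simp only [LinearMap.restrictScalars_apply, hA]
    have e1 : ∑ a, (q : ℂ)⁻¹ * (u a - c * (∑ b, u b * conj (z b)) * z a) *
        conj ((q : ℂ)⁻¹ * (v a - c * (∑ b, v b * conj (z b)) * z a)) =
        ((q : ℂ)⁻¹) ^ 2 * ((∑ a, u a * conj (v a)) - (2 * c - c ^ 2 * r) *
          ((∑ a, u a * conj (z a)) * ∑ a, z a * conj (v a))) := by
      have hcc : conj c = c := by simp [hc]
      have e2 : conj (∑ b, v b * conj (z b)) = ∑ b, z b * conj (v b) := by
        rw [map_sum]
        exact Finset.sum_congr rfl fun b _ => by simp [mul_comm]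
      simp only [map_mul, map_sub, hcc, e2, map_inv₀, Complex.conj_ofReal]
      set S := ∑ b, u b * conj (z b)
      set T := ∑ b, z b * conj (v b)
      have e3 : ∀ a, (q : ℂ)⁻¹ * (u a - c * S * z a) *
          ((q : ℂ)⁻¹ * (conj (v a) - c * T * conj (z a))) =
          ((q : ℂ)⁻¹) ^ 2 * (u a * conj (v a) - c * T * (u a * conj (z a)) -
            c * S * (z a * conj (v a)) + c ^ 2 * S * T * (z a * conj (z a))) := fun a => by ring
      rw [Finset.sum_congr rfl fun a _ => e3 a, ← Finset.mul_sum, Finset.sum_add_distrib,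
        Finset.sum_sub_distrib, Finset.sum_sub_distrib, ← Finset.mul_sum, ← Finset.mul_sum,
        ← Finset.mul_sum, hz]
      ring
    have e4 : 2 * c - c ^ 2 * r = ((q : ℂ) ^ 2)⁻¹ := by
      rw [show (r : ℂ) = q ^ 2 - 1 by rw [hq2C]; ring, hc]
      field_simp
      ring
    rw [e1, e4, ← hr, ← hq2]
    set S := (∑ a, u a * conj (z a)) * ∑ a, z a * conj (v a)
    set T := ∑ a, u a * conj (v a)
    have e5 : ((q : ℂ)⁻¹) ^ 2 * (T - ((q : ℂ) ^ 2)⁻¹ * S) =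
        (((q ^ 2) ^ 2)⁻¹ : ℝ) * ((q ^ 2 : ℝ) * T - S) := by
      push_cast
      field_simp
    rw [e5, Complex.im_ofReal_mul]
    field_simp
  rw [fubiniStudyVolume, hform, topPower_comp, mul_comm]
  congr 1
  have hdot : (fun a => conj (z a)) ⬝ᵥ (-c • z) = -c * r := by
    rw [dotProduct_smul, ← hz, smul_eq_mul]
    congr 1
    exact Finset.sum_congr rfl fun a _ => mul_comm _ _
  rw [LinearMap.det_restrictScalars, LinearMap.det_toLin', hM, Matrix.det_smul,
    Matrix.det_one_add_replicateCol_mul_replicateRow, hdot, Algebra.norm_complex_apply,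
    Fintype.card_fin]
  have e6 : 1 + -c * r = (q : ℂ)⁻¹ := by
    rw [show (r : ℂ) = q ^ 2 - 1 by rw [hq2C]; ring, hc]
    field_simp
    ring
  rw [e6, ← pow_succ, map_pow, map_inv₀, Complex.normSq_ofReal, ← sq, hq2, inv_pow]

/-! ### Divergence in homogeneous coordinates -/

/-- The Wirtinger derivative `∂u/∂X_k` of a complex-valued function. -/
def dz {m : ℕ} (u : (Fin m → ℂ) → ℂ) (x : Fin m → ℂ) (k : Fin m) : ℂ :=
  1 / 2 * (fderiv ℝ u x (Pi.single k 1) - I * fderiv ℝ u x (Pi.single k I))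

/-- `u` is real differentiable at `x` and `∂u/∂X_k = d` there. -/
def HasDz {m : ℕ} (u : (Fin m → ℂ) → ℂ) (d : ℂ) (x : Fin m → ℂ) (k : Fin m) : Prop :=
  DifferentiableAt ℝ u x ∧ dz u x k = d

theorem _root_.DifferentiableAt.hasDz {m : ℕ} {u : (Fin m → ℂ) → ℂ} {x : Fin m → ℂ}
    (h : DifferentiableAt ℝ u x) (k : Fin m) : HasDz u (dz u x k) x k := ⟨h, rfl⟩

namespace HasDz

variable {m : ℕ} {u v : (Fin m → ℂ) → ℂ} {d e : ℂ} {x : Fin m → ℂ} {k : Fin m}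

theorem const (c : ℂ) : HasDz (fun _ => c) 0 x k := by
  refine ⟨differentiableAt_const c, ?_⟩
  simp [dz]

theorem mul (hu : HasDz u d x k) (hv : HasDz v e x k) :
    HasDz (fun y => u y * v y) (d * v x + u x * e) x k := by
  refine ⟨hu.1.mul hv.1, ?_⟩
  rw [← hu.2, ← hv.2, dz, fderiv_fun_mul hu.1 hv.1]
  simp only [_root_.add_apply, _root_.smul_apply, smul_eq_mul, dz]
  ring

theorem sub (hu : HasDz u d x k) (hv : HasDz v e x k) :
    HasDz (fun y => u y - v y) (d - e) x k := by
  refine ⟨hu.1.sub hv.1, ?_⟩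
  rw [← hu.2, ← hv.2, dz, fderiv_fun_sub hu.1 hv.1]
  simp only [_root_.sub_apply, dz]
  ring

theorem const_mul (c : ℂ) (hu : HasDz u d x k) : HasDz (fun y => c * u y) (c * d) x k := by
  simpa using (const c).mul hu

theorem neg (hu : HasDz u d x k) : HasDz (fun y => -u y) (-d) x k := by
  simpa using hu.const_mul (-1)

theorem sum {ι : Type*} {s : Finset ι} {u : ι → (Fin m → ℂ) → ℂ} {d : ι → ℂ}
    (h : ∀ i ∈ s, HasDz (u i) (d i) x k) :
    HasDz (fun y => ∑ i ∈ s, u i y) (∑ i ∈ s, d i) x k := by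
  refine ⟨DifferentiableAt.fun_sum fun i hi => (h i hi).1, ?_⟩
  rw [dz, fderiv_fun_sum fun i hi => (h i hi).1, ← Finset.sum_congr rfl fun i hi => (h i hi).2]
  simp only [_root_.sum_apply, dz, Finset.mul_sum, ← Finset.sum_sub_distrib]

theorem coord (x : Fin m → ℂ) (k l : Fin m) :
    HasDz (fun y => y l) (if l = k then 1 else 0) x k := by
  refine ⟨differentiableAt_apply l x, ?_⟩
  rw [dz, (hasFDerivAt_apply (𝕜 := ℝ) l x).fderiv]
  by_cases h : l = k
  · subst h
    simp
    ring
  · simp [h]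

theorem conj_coord (x : Fin m → ℂ) (k l : Fin m) : HasDz (fun y => conj (y l)) 0 x k := by
  have h := Complex.conjCLE.hasFDerivAt.comp x (hasFDerivAt_apply (𝕜 := ℝ) l x)
  refine ⟨h.differentiableAt, ?_⟩
  change dz (⇑Complex.conjCLE ∘ fun f : Fin m → ℂ => f l) x k = 0
  rw [dz, h.fderiv]
  by_cases h : l = k
  · subst h
    simp
  · simp [h]

theorem normSq_coord (x : Fin m → ℂ) (k l : Fin m) :
    HasDz (fun y => (Complex.normSq (y l) : ℂ)) (if l = k then conj (x l) else 0) x k := by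
  have := (coord x k l).mul (conj_coord x k l)
  simp only [Complex.mul_conj] at this
  convert this using 1
  simp

end HasDz

/-- The divergence of a vector field is twice the real part of its complex divergence. -/
theorem trace_fderiv {n : ℕ} {w : (Fin n → ℂ) → Fin n → ℂ} {z : Fin n → ℂ}
    (hw : DifferentiableAt ℝ w z) :
    LinearMap.trace ℝ (Fin n → ℂ) (fderiv ℝ w z : (Fin n → ℂ) →ₗ[ℝ] _) =
      2 * (∑ a, dz (fun y => w y a) z a).re := by
  have hc : ∀ u a, fderiv ℝ (fun y => w y a) z u = fderiv ℝ w z u a := fun u a => by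
    have := hasFDerivAt_pi'.1 hw.hasFDerivAt a
    rw [this.fderiv]
    rfl
  rw [LinearMap.trace_eq_matrix_trace ℝ (realBasis n), Matrix.trace, Fintype.sum_prod_type,
    Complex.re_sum, Finset.mul_sum]
  refine Finset.sum_congr rfl fun a _ => ?_
  simp only [Fin.sum_univ_two, Matrix.diag_apply, LinearMap.toMatrix_apply, realBasis_apply,
    realBasis_repr, realFrame, dz, hc]
  simp

theorem fderiv_comp_affineVec {n : ℕ} {u : (Fin (n + 1) → ℂ) → ℂ} {j : Fin (n + 1)}
    {z : Fin n → ℂ} (hu : DifferentiableAt ℝ u (affineVec j z)) :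
    DifferentiableAt ℝ (fun z => u (affineVec j z)) z ∧
    ∀ a, dz (fun z => u (affineVec j z)) z a = dz u (affineVec j z) (j.succAbove a) := by
  have h1 : DifferentiableAt ℝ (fun z => u (affineVec j z)) z :=
    DifferentiableAt.comp (g := u) z hu ((contDiff_affineVec j).differentiable (by simp) z)
  refine ⟨h1, fun a => ?_⟩
  have h2 : ∀ c : ℂ, fderiv ℝ (fun z => u (affineVec j z)) z (Pi.single a c) =
      fderiv ℝ u (affineVec j z) (Pi.single (j.succAbove a) c) := fun c => by
    have h3 := hasDerivAt_comp_line h1 (Pi.single a c)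
    have h4 := hasDerivAt_comp_line hu (Pi.single (j.succAbove a) c)
    have h5 : ∀ s : ℝ, affineVec j (z + s • (Pi.single a c : Fin n → ℂ)) =
        affineVec j z + s • (Pi.single (j.succAbove a) c : Fin (n + 1) → ℂ) := fun s => by
      ext k
      rcases Fin.eq_self_or_eq_succAbove j k with rfl | ⟨b, rfl⟩
      · simp
      · by_cases hb : b = a
        · subst hb; simp
        · simp [hb]
    simp only [h5] at h3
    exact h3.unique h4
  rw [dz, dz, h2, h2]

/-- Euler's relation for vector fields that are homogeneous of degree one. -/
theorem sum_dz_mul_coord {m : ℕ} {v : (Fin m → ℂ) → Fin m → ℂ}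
    (hv' : ∀ c : ℂ, c ≠ 0 → ∀ x, x ≠ 0 → v (c • x) = c • v x) {x : Fin m → ℂ} (hx : x ≠ 0)
    (k : Fin m) (hd : DifferentiableAt ℝ (fun y => v y k) x) :
    ∑ l, dz (fun y => v y k) x l * x l = v x k := by
  have h1 : ∀ c : ℂ, fderiv ℝ (fun y => v y k) x (c • x) = c * v x k := fun c => by
    have h2 := hasDerivAt_comp_line hd (c • x)
    have h3 : HasDerivAt (fun s : ℝ => (1 + s * c) * v x k) (c * v x k) 0 := by
      have : HasDerivAt (fun s : ℝ => (1 + (s : ℂ) * c)) c 0 := by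
        simpa using ((Complex.ofRealCLM.hasDerivAt (x := (0 : ℝ))).mul_const c).const_add 1
      exact this.mul_const (v x k)
    have h5 : ∀ᶠ s : ℝ in nhds 0, (1 + (s : ℂ) * c) ≠ 0 := by
      have : ContinuousAt (fun s : ℝ => (1 + (s : ℂ) * c)) 0 := by fun_prop
      exact this.eventually_ne (by simp)
    refine h2.unique (h3.congr_of_eventuallyEq ?_)
    filter_upwards [h5] with s hs
    rw [show x + s • c • x = (1 + s * c) • x by rw [add_smul, one_smul, mul_smul]; rfl,
      hv' _ hs x hx]
    rfl
  set ℓ := fderiv ℝ (fun y => v y k) x with hℓ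
  have h2 : ∀ u : Fin m → ℂ, ℓ u = ∑ l, (((u l).re : ℂ) * ℓ (Pi.single l 1) +
      ((u l).im : ℂ) * ℓ (Pi.single l I)) := fun u => by
    conv_lhs => rw [← Finset.univ_sum_single u]
    rw [map_sum]
    refine Finset.sum_congr rfl fun l _ => ?_
    have : (Pi.single l (u l) : Fin m → ℂ) =
        (u l).re • (Pi.single l 1 : Fin m → ℂ) + (u l).im • (Pi.single l I : Fin m → ℂ) := by
      rw [← Pi.single_smul, ← Pi.single_smul, ← Pi.single_add]
      simp
    rw [this, map_add, map_smul, map_smul, Complex.real_smul, Complex.real_smul]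
  have h3 : v x k = 1 / 2 * (ℓ ((1 : ℂ) • x) - I * ℓ (I • x)) := by
    rw [h1, h1, ← mul_assoc, Complex.I_mul_I]
    ring
  rw [h3, h2, h2, Finset.mul_sum, ← Finset.sum_sub_distrib, Finset.mul_sum]
  refine Finset.sum_congr rfl fun l _ => ?_
  rw [dz, ← hℓ]
  simp only [one_mul, Pi.smul_apply, smul_eq_mul, Complex.I_mul_re, Complex.I_mul_im]
  push_cast
  linear_combination (1 / 2 * ℓ (Pi.single l 1) - I / 2 * ℓ (Pi.single l I)) *
    (Complex.re_add_im (x l)).symm - ℓ (Pi.single l I) * (x l).im / 2 * Complex.I_sq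

/-- The divergence with respect to the Fubini-Study volume of the vector field on projective space
induced by a homogeneous vector field `v` on `ℂⁿ⁺¹ ∖ {0}` is the divergence of `v` with respect to
the scale invariant volume `|X|^{-2(n+1)} dX`. -/
theorem isDivergence_fubiniStudyVolume {n : ℕ} {X : VectorField n}
    {v : (Fin (n + 1) → ℂ) → Fin (n + 1) → ℂ}
    (hX : ∀ (g : C n) (x : Fin (n + 1) → ℂ) (hx : x ≠ 0),
      (X g : CP n → ℝ) (Projectivization.mk ℂ x hx) = fderiv ℝ (lift (g : CP n → ℝ)) x (v x))
    (hv : ∀ j, ContDiff ℝ ∞ fun z => v (affineVec j z))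
    (hv' : ∀ c : ℂ, c ≠ 0 → ∀ x, x ≠ 0 → v (c • x) = c • v x)
    (hd : ∀ x, x ≠ 0 → ∀ k, DifferentiableAt ℝ (fun y => v y k) x) {d : C n}
    (h : ∀ (x : Fin (n + 1) → ℂ) (hx : x ≠ 0), (d : CP n → ℝ) (Projectivization.mk ℂ x hx) =
      2 * (∑ k, dz (fun y => v y k) x k).re -
        2 * (n + 1) * (∑ k, v x k * conj (x k)).re / ∑ l, Complex.normSq (x l)) :
    IsDivergence (fubiniStudyVolume n) X d := by
  have hX' : X = descend v hv hv' := by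
    ext g p
    induction p using Projectivization.ind with
    | h x hx => rw [hX, descend_mk]
  subst hX'
  intro j
  refine ⟨_, represents_descend v hv hv' j, fun z => ?_⟩
  set x := affineVec j z with hx
  have hx0 : x ≠ 0 := affineVec_ne_zero j z
  set K := topPower (fun u v => stdForm n u v) realFrame with hK
  have hN : ∑ l, Complex.normSq (x l) = 1 + ∑ a, Complex.normSq (z a) := by
    rw [Fin.sum_univ_succAbove _ j, hx]
    simp
  set N : ℝ := ∑ l, Complex.normSq (x l) with hNdef
  have hN0 : N ≠ 0 := (sum_normSq_pos hx0).ne'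
  have hNC : (N : ℂ) ≠ 0 := by exact_mod_cast hN0
  -- the logarithmic derivative of the volume density
  have hV : ∀ a, HasDz (fun w => (fubiniStudyVolume n j w : ℂ))
      (-(fubiniStudyVolume n j z * ((n + 1) / N * conj (z a)))) z a := fun a => by
    have h1 : HasDz (fun w => ((1 + ∑ b, Complex.normSq (w b) : ℝ) : ℂ)) (conj (z a)) z a := by
      have := (HasDz.sum (s := Finset.univ) fun b _ => HasDz.normSq_coord z a b).sub
        (HasDz.const (-1))
      convert this using 1
      · ext w
        push_cast
        ring
      · simp
    have h2 : ∀ w : Fin n → ℂ, (1 + ∑ b, Complex.normSq (w b)) ≠ 0 := fun w => by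
      have := Finset.sum_nonneg fun b (_ : b ∈ Finset.univ) => Complex.normSq_nonneg (w b)
      positivity
    have h3 : (fun w => (fubiniStudyVolume n j w : ℂ)) = fun w =>
        K * (((1 + ∑ b, Complex.normSq (w b) : ℝ) : ℂ) ^ (n + 1))⁻¹ := by
      ext w
      rw [fubiniStudyVolume_eq]
      push_cast
      rfl
    have hu := (h1.1.hasFDerivAt)
    have h4 := ((hasDerivAt_pow (n + 1)
      ((1 + ∑ b, Complex.normSq (z b) : ℝ) : ℂ)).fun_inv (pow_ne_zero _
        (by rw [← hN]; exact hNC))).const_mul (K : ℂ)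
    have h5 := (h4.hasFDerivAt.restrictScalars ℝ).comp z hu
    have h6 : HasFDerivAt (fun w => (fubiniStudyVolume n j w : ℂ)) _ z :=
      h5.congr_of_eventuallyEq (Filter.Eventually.of_forall (congrFun h3))
    refine ⟨h6.differentiableAt, ?_⟩
    rw [dz, h6.fderiv, fubiniStudyVolume_eq, ← h1.2, dz, ← hN, ← hK]
    simp
    field_simp
    ring
  have hξ : ∀ a, HasDz (fun w => v (affineVec j w) (j.succAbove a) - v (affineVec j w) j * w a)
      (dz (fun y => v y (j.succAbove a)) x (j.succAbove a) -
        (dz (fun y => v y j) x (j.succAbove a) * z a + v x j)) z a := fun a => by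
    have h1 := fun k => fderiv_comp_affineVec (hd x hx0 k)
    have h2 : ∀ k, HasDz (fun w => v (affineVec j w) k) (dz (fun y => v y k) x (j.succAbove a))
      z a := fun k => ⟨(h1 k).1, (h1 k).2 a⟩
    have := (h2 (j.succAbove a)).sub ((h2 j).mul (HasDz.coord z a a))
    simpa using this
  have hVξ := fun a => (hV a).mul (hξ a)
  have hdiff : DifferentiableAt ℝ (fun w => fubiniStudyVolume n j w • fun a =>
      v (affineVec j w) (j.succAbove a) - v (affineVec j w) j * w a) z := by
    refine differentiableAt_pi.2 fun a => ?_
    have := (hVξ a).1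
    simpa only [Pi.smul_apply, Complex.real_smul] using this
  rw [trace_fderiv hdiff, affineChart, h]
  have hsum : ∀ a, dz (fun y => (fubiniStudyVolume n j y • fun a =>
      v (affineVec j y) (j.succAbove a) - v (affineVec j y) j * y a) a) z a = _ :=
    fun a => (hVξ a).2
  rw [Finset.sum_congr rfl fun a _ => hsum a]
  set V := fubiniStudyVolume n j z
  have hE := sum_dz_mul_coord hv' hx0 j (hd x hx0 j)
  rw [Fin.sum_univ_succAbove _ j] at hE
  have hxj : x j = 1 := affineVec_same j z
  have hxa : ∀ a, x (j.succAbove a) = z a := affineVec_succAbove j z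
  simp only [hxj, hxa, mul_one] at hE
  have hzz : ∑ a, z a * conj (z a) = (N : ℂ) - 1 := by
    rw [hN]
    push_cast
    rw [add_sub_cancel_left]
    exact Finset.sum_congr rfl fun a _ => Complex.mul_conj _
  have e1 : ∑ a, (-(V * ((n + 1) / N * conj (z a))) * (v x (j.succAbove a) - v x j * z a) +
      V * (dz (fun y => v y (j.succAbove a)) x (j.succAbove a) -
        (dz (fun y => v y j) x (j.succAbove a) * z a + v x j))) =
      V * (∑ k, dz (fun y => v y k) x k - (n + 1) / N * ∑ k, v x k * conj (x k)) := by
    have e2 : ∀ a, (-(V * ((n + 1) / N * conj (z a))) * (v x (j.succAbove a) - v x j * z a) +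
        V * (dz (fun y => v y (j.succAbove a)) x (j.succAbove a) -
          (dz (fun y => v y j) x (j.succAbove a) * z a + v x j))) =
        V * (dz (fun y => v y (j.succAbove a)) x (j.succAbove a) -
          dz (fun y => v y j) x (j.succAbove a) * z a - v x j -
          (n + 1) / N * (v x (j.succAbove a) * conj (z a)) +
          (n + 1) / N * v x j * (z a * conj (z a))) := fun a => by ring
    rw [Finset.sum_congr rfl fun a _ => e2 a, ← Finset.mul_sum, Finset.sum_add_distrib,
      Finset.sum_sub_distrib, Finset.sum_sub_distrib, Finset.sum_sub_distrib, ← Finset.mul_sum,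
      ← Finset.mul_sum, hzz, Fin.sum_univ_succAbove (fun k => dz (fun y => v y k) x k) j,
      Fin.sum_univ_succAbove (fun k => v x k * conj (x k)) j]
    simp only [hxj, hxa, map_one, mul_one, Finset.sum_const, Finset.card_univ, Fintype.card_fin,
      nsmul_eq_mul]
    rw [← hE]
    field_simp
    ring
  refine (congrArg (fun c : ℂ => 2 * c.re) e1).trans ?_
  have e3 : ((n : ℂ) + 1) / N = (((n + 1) / N : ℝ) : ℂ) := by push_cast; rfl
  rw [Complex.re_ofReal_mul, Complex.sub_re, e3, Complex.re_ofReal_mul]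
  ring

/-! ### The divergence of the Hamiltonian vector fields -/

theorem pencilSharp_smul {m : ℕ} (t : ℝ) {c : ℂ} (hc : c ≠ 0) (x α : Fin m → ℂ) :
    pencilSharp t (c • x) (c⁻¹ • α) = c • pencilSharp t x α := by
  have hc' : conj c ≠ 0 := (map_ne_zero _).2 hc
  ext k
  have h1 : ∀ l, c * x l * (c⁻¹ * α l) = x l * α l := fun l => by field_simp
  have h2 : (pencilWeight t (c • x) k : ℂ) = c * conj c * pencilWeight t x k := by
    rw [Complex.mul_conj, ← Complex.ofReal_mul]
    congr 1
    simp only [pencilWeight, Pi.smul_apply, smul_eq_mul, map_mul, Finset.mul_sum]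
    exact Finset.sum_congr rfl fun l _ => by ring
  simp only [pencilSharp, Pi.smul_apply, smul_eq_mul, h1, h2, map_mul, map_inv₀]
  field_simp

theorem contDiff_pencilSharp {n : ℕ} (t : ℝ) (f : C n) (j : Fin (n + 1)) :
    ContDiff ℝ ∞ fun z => pencilSharp t (affineVec j z)
      (wirtinger (lift (f : CP n → ℝ)) (affineVec j z)) := by
  refine contDiff_pi.2 fun k => ?_
  have hx := contDiff_pi.1 (contDiff_affineVec (n := n) j)
  have hF := fun l => contDiff_wirtinger_lift f j l
  refine ((contDiff_const.mul (ContDiff.sum fun l _ => contDiff_const.mul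
    ((hx l).mul (hF l)))).mul (hx k)).sub ((contDiff_const.mul
      (Complex.ofRealCLM.contDiff.comp ?_)).mul (Complex.conjCLE.contDiff.comp (hF k)))
  exact ContDiff.sum (s := Finset.univ) fun l _ => contDiff_const.mul (contDiff_normSq' (hx l))

/-- The mixed derivatives `∂_k ∂_l f` are symmetric. -/
theorem dz_wirtinger_symm {n : ℕ} (f : C n) {x : Fin (n + 1) → ℂ} (hx : x ≠ 0)
    (k l : Fin (n + 1)) :
    dz (fun y => wirtinger (lift (f : CP n → ℝ)) y l) x k =
      dz (fun y => wirtinger (lift (f : CP n → ℝ)) y k) x l := by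
  simp only [dz, fderiv_wirtinger_lift f hx]
  rw [fderiv_fderiv_lift_symm f hx (Pi.single k 1) (Pi.single l 1),
    fderiv_fderiv_lift_symm f hx (Pi.single k 1) (Pi.single l I),
    fderiv_fderiv_lift_symm f hx (Pi.single k I) (Pi.single l 1),
    fderiv_fderiv_lift_symm f hx (Pi.single k I) (Pi.single l I)]
  ring

/-- `∂_k ∂̄_k f`, a quarter of the Laplacian in the variable `X_k`, is real. -/
theorem hasDz_conj_wirtinger {n : ℕ} (f : C n) {x : Fin (n + 1) → ℂ} (hx : x ≠ 0)
    (k : Fin (n + 1)) : ∃ r : ℝ,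
    HasDz (fun y => conj (wirtinger (lift (f : CP n → ℝ)) y k)) r x k := by
  have h := Complex.conjCLE.hasFDerivAt.comp x (differentiableAt_wirtinger_lift f hx k).hasFDerivAt
  have e : (fun y => conj (wirtinger (lift (f : CP n → ℝ)) y k)) =
      ⇑Complex.conjCLE ∘ fun y => wirtinger (lift (f : CP n → ℝ)) y k := rfl
  refine ⟨1 / 4 * (fderiv ℝ (fderiv ℝ (lift (f : CP n → ℝ))) x (Pi.single k 1) (Pi.single k 1) +
    fderiv ℝ (fderiv ℝ (lift (f : CP n → ℝ))) x (Pi.single k I) (Pi.single k I)),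
    h.differentiableAt, ?_⟩
  rw [e, dz, h.fderiv]
  simp only [ContinuousLinearMap.comp_apply, fderiv_wirtinger_lift f hx]
  rw [fderiv_fderiv_lift_symm f hx (Pi.single k I) (Pi.single k 1)]
  apply Complex.ext
  · simp
    ring
  · simp

theorem sum_ordSign {n : ℕ} (l : Fin (n + 1)) :
    ∑ k, ordSign k l = 2 * ((l : ℕ) : ℝ) - n := by
  have h1 : ∀ k : Fin (n + 1), ordSign k l = (if k < l then 1 else 0) - if l < k then 1 else 0 :=
    fun k => by
      unfold ordSign
      rcases lt_trichotomy k l with h | h | h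
      · simp [h, h.not_gt]
      · simp [h]
      · simp [h, h.not_gt]
  rw [Finset.sum_congr rfl fun k _ => h1 k, Finset.sum_sub_distrib, ← Finset.sum_filter,
    ← Finset.sum_filter, Finset.sum_const, Finset.sum_const, Finset.filter_lt_eq_Ioi,
    Finset.filter_gt_eq_Iio, Fin.card_Ioi, Fin.card_Iio, nsmul_one, nsmul_one,
    Nat.add_sub_cancel, Nat.cast_sub (by omega)]
  ring

/-- The Hamiltonian vector fields of homogeneous functions are tangent to the spheres. -/
theorem re_sum_pencilSharp_mul_conj {m : ℕ} (t : ℝ) (x α : Fin m → ℂ) (h : ∑ l, x l * α l = 0) :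
    (∑ k, pencilSharp t x α k * conj (x k)).re = 0 := by
  have h1 : ∑ k, pencilSharp t x α k * conj (x k) =
      ∑ l, ∑ k, (I / 2 * (ordSign k l * (x l * α l) * Complex.normSq (x k)) -
        I * (((1 + ordSign l k) / 2 - t : ℝ) * Complex.normSq (x k) * conj (x l * α l))) := by
    simp only [Finset.sum_sub_distrib]
    rw [Finset.sum_comm (f := fun l k =>
      I / 2 * (ordSign k l * (x l * α l) * Complex.normSq (x k))), ← Finset.sum_sub_distrib]
    refine Finset.sum_congr rfl fun k _ => ?_
    rw [pencilSharp, pencilWeight, ← Finset.mul_sum, ← Finset.mul_sum, ← Finset.sum_mul,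
      ← Finset.sum_mul, ← Complex.mul_conj (x k)]
    push_cast
    rw [map_mul]
    ring
  have h2 : ∀ l k, (I / 2 * (ordSign k l * (x l * α l) * Complex.normSq (x k)) -
      I * (((1 + ordSign l k) / 2 - t : ℝ) * Complex.normSq (x k) * conj (x l * α l))).re =
      -(1 / 2 - t) * ((x l * α l).im * Complex.normSq (x k)) := fun l k => by
    rw [ordSign_swap k l]
    generalize x l * α l = a
    generalize Complex.normSq (x k) = b
    simp
    ring
  rw [h1]
  simp only [Complex.re_sum, h2]
  have h3 : ∑ l, (x l * α l).im = 0 := by rw [← Complex.im_sum, h, Complex.zero_im]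
  simp only [← Finset.mul_sum, ← Finset.sum_mul, h3, zero_mul, mul_zero]

/-- The complex divergence of the homogeneous lift of `{f, ·}`. By the symmetry of the second
derivatives, only the derivatives of the coefficients of the bivector contribute. -/
theorem re_sum_dz_pencilSharp {n : ℕ} (t : ℝ) (f : C n) {x : Fin (n + 1) → ℂ} (hx : x ≠ 0) :
    (∀ k, DifferentiableAt ℝ
      (fun y => pencilSharp t y (wirtinger (lift (f : CP n → ℝ)) y) k) x) ∧
    (∑ k, dz (fun y => pencilSharp t y (wirtinger (lift (f : CP n → ℝ)) y) k) x k).re =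
      -∑ k, (wirtinger (lift (f : CP n → ℝ)) x k * (I * (n / 2 - (k : ℕ) : ℝ) * x k)).re := by
  set F := wirtinger (lift (f : CP n → ℝ)) with hF
  have hFd : ∀ l k, HasDz (fun y => F y l) (dz (fun y => F y l) x k) x k := fun l k =>
    (differentiableAt_wirtinger_lift f hx l).hasDz k
  choose r hr using hasDz_conj_wirtinger f hx
  have hW : ∀ k, HasDz (fun y => (pencilWeight t y k : ℂ)) ((1 / 2 - t : ℝ) * conj (x k)) x k :=
    fun k => by
      have := HasDz.sum (s := Finset.univ) fun l _ =>
        (HasDz.normSq_coord x k l).const_mul (((1 + ordSign k l) / 2 - t : ℝ) : ℂ)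
      convert this using 1
      · ext y
        rw [pencilWeight]
        push_cast
        rfl
      · simp
  have hY : ∀ k, HasDz (fun y => pencilSharp t y (F y) k) _ x k := fun k =>
    (((HasDz.sum (s := Finset.univ) fun l _ => ((HasDz.coord x k l).mul (hFd l k)).const_mul
      (ordSign k l : ℂ)).const_mul (I / 2)).mul (HasDz.coord x k k)).sub
        (((hW k).const_mul I).mul (hr k))
  refine ⟨fun k => (hY k).1, ?_⟩
  rw [Finset.sum_congr rfl fun k _ => (hY k).2]
  have hE := sum_wirtinger_lift f hx
  rw [← hF] at hE
  have e1 : ∀ k, ∑ l, (ordSign k l : ℂ) * ((if l = k then 1 else 0) * F x l +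
      x l * dz (fun y => F y l) x k) = ∑ l, (ordSign k l : ℂ) * (x l * dz (fun y => F y l) x k) :=
    fun k => Finset.sum_congr rfl fun l _ => by
      by_cases h : l = k
      · simp [h]
      · simp [h]
  have e2 : ∑ k, (∑ l, (ordSign k l : ℂ) * (x l * dz (fun y => F y l) x k)) * x k = 0 := by
    have h1 : ∑ k, (∑ l, (ordSign k l : ℂ) * (x l * dz (fun y => F y l) x k)) * x k =
        ∑ k, ∑ l, (ordSign k l : ℂ) * (x l * x k * dz (fun y => F y l) x k) :=
      Finset.sum_congr rfl fun k _ => by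
        rw [Finset.sum_mul]
        exact Finset.sum_congr rfl fun l _ => by ring
    have h2 := Finset.sum_comm (s := Finset.univ) (t := Finset.univ) (f := fun k l =>
      (ordSign k l : ℂ) * (x l * x k * dz (fun y => F y l) x k))
    have h3 : ∑ l, ∑ k, (ordSign k l : ℂ) * (x l * x k * dz (fun y => F y l) x k) =
        -∑ l, ∑ k, (ordSign l k : ℂ) * (x k * x l * dz (fun y => F y k) x l) := by
      rw [← Finset.sum_neg_distrib]
      refine Finset.sum_congr rfl fun l _ => ?_
      rw [← Finset.sum_neg_distrib]
      refine Finset.sum_congr rfl fun k _ => ?_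
      rw [ordSign_swap l k, hF, dz_wirtinger_symm f hx k l]
      push_cast
      ring
    rw [h1]
    exact self_eq_neg.1 (h2.trans h3)
  have e3 : ∑ k, ∑ l, (ordSign k l : ℂ) * (x l * F x l) =
      ∑ l : Fin (n + 1), ((2 * ((l : ℕ) : ℝ) - n : ℝ) : ℂ) * (x l * F x l) := by
    rw [Finset.sum_comm]
    refine Finset.sum_congr rfl fun l _ => ?_
    rw [← Finset.sum_mul, ← Complex.ofReal_sum, sum_ordSign]
  have e4 : ∀ k, I / 2 * (∑ l, (ordSign k l : ℂ) * ((if l = k then 1 else 0) * F x l +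
        x l * dz (fun y => F y l) x k)) * x k +
      I / 2 * (∑ l, (ordSign k l : ℂ) * (x l * F x l)) * (if k = k then 1 else 0) -
      (I * ((1 / 2 - t : ℝ) * conj (x k)) * conj (F x k) + I * (pencilWeight t x k) * (r k)) =
      I / 2 * ((∑ l, (ordSign k l : ℂ) * (x l * dz (fun y => F y l) x k)) * x k) +
      I / 2 * (∑ l, (ordSign k l : ℂ) * (x l * F x l)) -
      I * (1 / 2 - t : ℝ) * conj (x k * F x k) - I * ((pencilWeight t x k * r k : ℝ) : ℂ) :=
    fun k => by
      rw [e1, if_pos rfl, map_mul]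
      push_cast
      ring
  rw [Finset.sum_congr rfl fun k _ => e4 k, Finset.sum_sub_distrib, Finset.sum_sub_distrib,
    Finset.sum_add_distrib, ← Finset.mul_sum, ← Finset.mul_sum, ← Finset.mul_sum, ← Finset.mul_sum,
    e2, e3, ← map_sum, hE, ← Complex.ofReal_sum]
  simp only [mul_zero, map_zero, zero_add, sub_zero, Complex.sub_re, Complex.I_mul_re,
    Complex.ofReal_im, neg_zero]
  rw [Finset.mul_sum, Complex.re_sum, ← Finset.sum_neg_distrib]
  refine Finset.sum_congr rfl fun l _ => ?_
  rw [← Complex.neg_re]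
  congr 1
  push_cast
  ring

/-- The fundamental vector field of the half-sum of the positive roots is the modular vector
field. -/
theorem isModularVectorField_halfSum (n : ℕ) (t : ℝ) :
    IsModularVectorField (fubiniStudyVolume n) (pencil n t)
      (fundamental (halfSumPositiveRoots n)) := by
  intro f
  have hd := fun x (hx : x ≠ 0) => re_sum_dz_pencilSharp t f hx
  refine isDivergence_fubiniStudyVolume
    (v := fun x => -pencilSharp t x (wirtinger (lift (f : CP n → ℝ)) x)) (fun g x hx => ?_)
    (fun j => (contDiff_pencilSharp t f j).neg) (fun c hc x hx => ?_)
    (fun x hx k => ((hd x hx).1 k).neg) (fun x hx => ?_)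
  · rw [map_neg, ← pencil_mk' t f g hx]
    rfl
  · have : wirtinger (lift (f : CP n → ℝ)) (c • x) = c⁻¹ • wirtinger (lift (f : CP n → ℝ)) x :=
      funext fun k => wirtinger_lift_smul f hc hx k
    rw [this, pencilSharp_smul t hc, smul_neg]
  · have h1 : ∀ k, dz (fun y => (-pencilSharp t y (wirtinger (lift (f : CP n → ℝ)) y)) k) x k =
        -dz (fun y => pencilSharp t y (wirtinger (lift (f : CP n → ℝ)) y) k) x k := fun k =>
      (((hd x hx).1 k).hasDz k).neg.2
    rw [halfSumPositiveRoots_eq_diagonal, fundamental_diagonal_mk, fderiv_eq_wirtinger,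
      Finset.sum_congr rfl fun k _ => h1 k, Finset.sum_neg_distrib, Complex.neg_re, (hd x hx).2]
    simp only [Pi.neg_apply, neg_mul, Finset.sum_neg_distrib, Complex.neg_re,
      re_sum_pencilSharp_mul_conj t x _ (sum_wirtinger_lift f hx)]
    rw [neg_zero, mul_zero, zero_div, sub_zero, neg_neg]

end

end CPn

theorem mainTheorem8 (n : ℕ) (hn : 1 ≤ n) :
    (∀ (t : ℝ) (χ : CPn.VectorField n),
      CPn.IsModularVectorField (CPn.fubiniStudyVolume n) (CPn.pencil n t) χ ↔
        χ = ∑ k, CPn.fundamental (CPn.cartan n k)) ∧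
    (∑ k, CPn.cartan n k = CPn.halfSumPositiveRoots n ∧
      ∑ k, CPn.fundamental (CPn.cartan n k) =
        CPn.fundamental (CPn.halfSumPositiveRoots n)) ∧
    (∀ t : ℝ, ∃ hχ : (∑ k, CPn.fundamental (CPn.cartan n k)) ∈
        CPn.poissonVectorFields (CPn.pencil n t),
      t ∈ Set.Icc (0 : ℝ) 1 → CPn.lpClass hχ ≠ 0) := by
  have hsum : ∑ k, CPn.fundamental (CPn.cartan n k) =
      CPn.fundamental (CPn.halfSumPositiveRoots n) := by
    rw [CPn.fundamental_sum, CPn.sum_cartan]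
  have hV : ∀ j z, CPn.fubiniStudyVolume n j z ≠ 0 := fun j z => by
    rw [CPn.fubiniStudyVolume_eq]
    have := Finset.sum_nonneg fun a (_ : a ∈ Finset.univ) => Complex.normSq_nonneg (z a)
    exact mul_ne_zero (CPn.topPower_stdForm_ne_zero n) (by positivity)
  refine ⟨fun t χ => ⟨fun h => ?_, ?_⟩, ⟨CPn.sum_cartan n, hsum⟩, fun t => ⟨?_, fun ht => ?_⟩⟩
  · rw [hsum]
    exact CPn.isModularVectorField_unique hV h (CPn.isModularVectorField_halfSum n t)
  · rintro rfl
    rw [hsum]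
    exact CPn.isModularVectorField_halfSum n t
  · rw [hsum, CPn.halfSumPositiveRoots_eq_diagonal]
    exact CPn.fundamental_diagonal_mem_poissonVectorFields t _
  · intro h0
    obtain ⟨m, rfl⟩ := Nat.exists_eq_add_of_le' hn
    rw [CPn.lpClass, Submodule.Quotient.mk_eq_zero] at h0
    obtain ⟨f, hf⟩ := Submodule.mem_comap.1 h0
    exact CPn.fundamental_halfSum_not_hamiltonian ht f (hf.trans hsum)
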